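/- Setting. The modes carry annihilation operators $a_i$ on Fock space; $|\beta\rangle$, $\beta\in\mathbb C^r$, is the (product) coherent state of $r$ modes. A state $\sigma$ of $r$ modes is \emph{classical} if $\sigma=\int|\beta\rangle\langle\beta|\,dP(\beta)$ for a Borel probability measure $P$ on $\mathbb C^r$. A unitary $U$ from $N$ input modes to $N$ output modes is \emph{passive linear} if it conserves the total particle number and $a_iU=U\sum_j u_{ij}a_j$ for a unitary matrix $u$. A family $I=(\mathcal A_m)_{m\in M}$ of linear maps from the trace class operators on $n$ modes to the trace class operators on $n'$ modes belongs to $\mathcal P_1$, \emph{realized with $r$ ancilla modes}, if for some $q$ with $n+r=n'+q$ there are a classical state $\sigma$ of $r$ modes, a passive linear unitary $U$ from $n+r$ to $n'+q$ modes and a POVM $(E^m)_{m\in M}$ on the last $q$ output modes $A'$ ($E^m\ge 0$, $\sum_m E^m=\mathbb 1$) with $$\mathcal A_m(\rho)=\operatorname{tr}_{A'}\!\left[E^m_{A'}\,U(\rho\otimes\sigma)U^\dagger\right]\qquad\text{for all } m \text{ and } \rho .$$ Lemma. Let $I=(\mathcal A_m)_{m\in M}$ be an instrument in $\mathcal P_1$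 from $n$ to $n'$ modes, realized with any number of ancilla modes. (1) Up to classical mixing, at most $n'$ ancilla modes suffice: there are $r\le n'$, a passive linear unitary $U'$, a probability space $(\Gamma,\mu)$ and, for each $\gamma\in\Gamma$, an instrument $I^\gamma=(\mathcal A^\gamma_m)_{m\in M}$ in $\mathcal P_1$, realized with $r$ ancilla modes, the unitary $U'$, a classical ancilla state $\sigma_\gamma$ and a POVM $(F^m_\gamma)_m$, such that $\mathcal A_m(\rho)=\int_\Gamma\mathcal A^\gamma_m(\rho)\,d\mu(\gamma)$ (as a weak integral) for all $m$ and all trace class $\rho$. (2) If $M$ has a single outcome (so that $E=\mathbb 1$, i.e. $I\in\mathcal P_0$), then no mixing is needed: $I$ itself is realized with some number $r\le n'$ of ancilla modes. (3) If $I$ is realized with its ancilla in a pure coherent state, then no mixing is needed either: $I$ itself is realized with some number $r\le n'$ of ancilla modes in a pure coherent state. -/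

import Mathlib

open scoped Matrix ENNReal

noncomputable section

namespace Bosonic

/-! ### Square-summable sequences and Fock space -/

/-- The Hilbert space `ℓ²(X; ℂ)`. -/
abbrev L2 (X : Type*) : Type _ := lp (fun _ : X => ℂ) 2

theorem summable_sq {X : Type*} (ψ : L2 X) : Summable fun x => ‖ψ x‖ ^ 2 := by
  simpa using (lp.memℓp ψ).summable (by simp)

theorem norm_sq_eq {X : Type*} (ψ : L2 X) : ‖ψ‖ ^ 2 = ∑' x, ‖ψ x‖ ^ 2 := by
  simpa using lp.norm_rpow_eq_tsum (p := 2) (by simp) ψ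

theorem memlp_two {X : Type*} {f : X → ℂ} (h : Summable fun x => ‖f x‖ ^ 2) :
    Memℓp (E := fun _ : X => ℂ) f 2 := memℓp_gen (by simpa using h)

/-- The Hilbert space of bosonic modes labelled by `ι`, in the occupation-number representation:
the basis vector labelled by `k : ι → ℕ` has `k i` particles in mode `i`. -/
abbrev Fock (ι : Type*) : Type _ := L2 (ι → ℕ)

/-- The number state `|k⟩`. -/
def numberState {ι : Type*} (k : ι → ℕ) : Fock ι := by
  classical exact lp.single 2 k (1 : ℂ)

/-- The matrix element `⟨k| T |l⟩` in the number basis. -/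
def entry {ι : Type*} (T : Fock ι →L[ℂ] Fock ι) (k l : ι → ℕ) : ℂ := T (numberState l) k

/-! ### Operators acting on one tensor factor -/

/-- With `Z` identified with `Y × X`, the component of `ψ` at a fixed `y`. -/
def slice {X Y Z : Type*} (e : Y × X ≃ Z) (ψ : L2 Z) (y : Y) : L2 X :=
  ⟨fun x => ψ (e (y, x)), memlp_two ((summable_sq ψ).comp_injective
    (i := fun x => e (y, x)) (e.injective.comp (Prod.mk_right_injective y)))⟩

theorem slice_summable {X Y Z : Type*} (e : Y × X ≃ Z) (ψ : L2 Z) :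
    Summable fun p : Y × X => ‖slice e ψ p.1 p.2‖ ^ 2 :=
  (e.summable_iff (f := fun z => ‖ψ z‖ ^ 2)).2 (summable_sq ψ)

theorem hasSum_norm_slice {X Y Z : Type*} (e : Y × X ≃ Z) (ψ : L2 Z) :
    HasSum (fun y => ‖slice e ψ y‖ ^ 2) (‖ψ‖ ^ 2) := by
  have h := slice_summable e ψ
  have h2 := h.prod
  have h3 : ∑' p : Y × X, ‖slice e ψ p.1 p.2‖ ^ 2 = ‖ψ‖ ^ 2 := by
    rw [norm_sq_eq]
    exact e.tsum_eq (fun z => ‖ψ z‖ ^ 2)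
  rw [← h3, h.tsum_prod]
  simpa only [norm_sq_eq] using h2.hasSum

theorem amplify_summable {X Y Z : Type*} (e : Y × X ≃ Z) (T : L2 X →L[ℂ] L2 X) (ψ : L2 Z) :
    Summable fun p : Y × X => ‖T (slice e ψ p.1) p.2‖ ^ 2 := by
  refine (summable_prod_of_nonneg (fun _ => by positivity)).2
    ⟨fun y => summable_sq (T (slice e ψ y)), ?_⟩
  refine Summable.of_nonneg_of_le (fun y => tsum_nonneg fun _ => by positivity) (fun y => ?_)
    ((hasSum_norm_slice e ψ).summable.mul_left (‖T‖ ^ 2))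
  refine (norm_sq_eq (T (slice e ψ y))).symm.le.trans ?_
  rw [← mul_pow]
  exact pow_le_pow_left₀ (norm_nonneg _) (T.le_opNorm _) 2

/-- The vector `(1 ⊗ T) ψ`, where `Z` is identified with `Y × X`. -/
def amplifyVec {X Y Z : Type*} (e : Y × X ≃ Z) (T : L2 X →L[ℂ] L2 X) (ψ : L2 Z) : L2 Z :=
  ⟨fun z => T (slice e ψ (e.symm z).1) (e.symm z).2, memlp_two
    ((e.symm.summable_iff (f := fun p : Y × X => ‖T (slice e ψ p.1) p.2‖ ^ 2)).2
      (amplify_summable e T ψ))⟩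

/-- The operator `1 ⊗ T` on `ℓ²(Z)`, where `Z` is identified with `Y × X` and `T` acts on
`ℓ²(X)`. -/
def amplify {X Y Z : Type*} (e : Y × X ≃ Z) (T : L2 X →L[ℂ] L2 X) : L2 Z →L[ℂ] L2 Z :=
  LinearMap.mkContinuous
    { toFun := amplifyVec e T
      map_add' := fun ψ φ => by
        ext z
        have : slice e (ψ + φ) (e.symm z).1
            = slice e ψ (e.symm z).1 + slice e φ (e.symm z).1 := by
          ext x; rfl
        change T (slice e (ψ + φ) (e.symm z).1) (e.symm z).2 = _
        rw [this, map_add]; rfl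
      map_smul' := fun c ψ => by
        ext z
        have : slice e (c • ψ) (e.symm z).1 = c • slice e ψ (e.symm z).1 := by
          ext x; rfl
        change T (slice e (c • ψ) (e.symm z).1) (e.symm z).2 = _
        rw [this, map_smul]; rfl }
    ‖T‖ (fun ψ => by
      have hs := amplify_summable e T ψ
      have h1 : ‖amplifyVec e T ψ‖ ^ 2 = ∑' p : Y × X, ‖T (slice e ψ p.1) p.2‖ ^ 2 := by
        rw [norm_sq_eq]
        exact e.symm.tsum_eq (fun p : Y × X => ‖T (slice e ψ p.1) p.2‖ ^ 2)
      have h2 : ‖amplifyVec e T ψ‖ ^ 2 ≤ (‖T‖ * ‖ψ‖) ^ 2 := by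
        rw [h1, hs.tsum_prod, mul_pow, ← ((hasSum_norm_slice e ψ).mul_left (‖T‖ ^ 2)).tsum_eq]
        refine hs.prod.tsum_le_tsum (fun y => ?_)
          ((hasSum_norm_slice e ψ).summable.mul_left (‖T‖ ^ 2))
        refine (norm_sq_eq (T (slice e ψ y))).symm.le.trans ?_
        rw [← mul_pow]
        exact pow_le_pow_left₀ (norm_nonneg _) (T.le_opNorm _) 2
      exact le_of_sq_le_sq h2 (by positivity))

/-- Occupation numbers of the modes `ι ⊕ κ`, the modes `κ` listed first. -/
def splitRight (ι κ : Type*) : (κ → ℕ) × (ι → ℕ) ≃ (ι ⊕ κ → ℕ) :=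
  (Equiv.prodComm _ _).trans (Equiv.sumArrowEquivProdArrow ι κ ℕ).symm

/-- Occupation numbers of the modes `ι ⊕ κ`, the modes `ι` listed first. -/
def splitLeft (ι κ : Type*) : (ι → ℕ) × (κ → ℕ) ≃ (ι ⊕ κ → ℕ) :=
  (Equiv.sumArrowEquivProdArrow ι κ ℕ).symm

/-- The operator `T ⊗ 1` on the modes `ι ⊕ κ`. -/
def onLeft {ι : Type*} (κ : Type*) (T : Fock ι →L[ℂ] Fock ι) :
    Fock (ι ⊕ κ) →L[ℂ] Fock (ι ⊕ κ) := amplify (splitRight ι κ) T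

/-- The operator `1 ⊗ T` on the modes `ι ⊕ κ`. -/
def onRight (ι : Type*) {κ : Type*} (T : Fock κ →L[ℂ] Fock κ) :
    Fock (ι ⊕ κ) →L[ℂ] Fock (ι ⊕ κ) := amplify (splitLeft ι κ) T

/-- The tensor product `T ⊗ T'` on the modes `ι ⊕ κ`. -/
def tensor {ι κ : Type*} (T : Fock ι →L[ℂ] Fock ι) (T' : Fock κ →L[ℂ] Fock κ) :
    Fock (ι ⊕ κ) →L[ℂ] Fock (ι ⊕ κ) := onLeft κ T ∘L onRight ι T'

/-! ### Trace class operators and partial trace -/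

/-- The trace class operators: the linear span of the positive operators of finite trace. -/
def traceClass (ι : Type*) : Submodule ℂ (Fock ι →L[ℂ] Fock ι) :=
  Submodule.span ℂ {T | T.IsPositive ∧ Summable fun k => entry T k k}

/-- `R` is the partial trace of `T` over the modes `κ`. -/
def IsPartialTrace {ι κ : Type*} (T : Fock (ι ⊕ κ) →L[ℂ] Fock (ι ⊕ κ))
    (R : Fock ι →L[ℂ] Fock ι) : Prop :=
  ∀ s t : ι → ℕ,
    HasSum (fun a : κ → ℕ => entry T (Sum.elim s a) (Sum.elim t a)) (entry R s t)

/-! ### Coherent and classical states -/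

/-- Amplitude of the coherent state `|α⟩` on the number state `|k⟩`:
`∏ i, exp (-|α i|² / 2) α i ^ k i / √(k i)!`. -/
def coherentCoeff {ι : Type*} [Fintype ι] (α : ι → ℂ) (k : ι → ℕ) : ℂ :=
  ∏ i, ((Real.exp (-‖α i‖ ^ 2 / 2) : ℝ) : ℂ) * α i ^ k i
    / ((Real.sqrt ((k i).factorial : ℝ) : ℝ) : ℂ)

theorem coherentCoeff_norm_sq {ι : Type*} [Fintype ι] (α : ι → ℂ) (k : ι → ℕ) :
    ‖coherentCoeff α k‖ ^ 2 =
      ∏ i, Real.exp (-‖α i‖ ^ 2) * ((‖α i‖ ^ 2) ^ k i / ((k i).factorial : ℝ)) := by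
  rw [coherentCoeff, norm_prod, ← Finset.prod_pow]
  refine Finset.prod_congr rfl fun i _ => ?_
  rw [norm_div, norm_mul, norm_pow, Complex.norm_real, Complex.norm_real, div_pow, mul_pow,
    Real.norm_of_nonneg (Real.exp_pos _).le, Real.norm_of_nonneg (Real.sqrt_nonneg _),
    Real.sq_sqrt (by positivity), ← Real.exp_nat_mul, mul_div_assoc, ← pow_mul, ← pow_mul,
    mul_comm 2 (k i)]
  congr 2
  push_cast
  ring

theorem coherentCoeff_summable {ι : Type*} [Fintype ι] (α : ι → ℂ) :
    Summable fun k => ‖coherentCoeff α k‖ ^ 2 := by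
  classical
  refine summable_of_sum_le (c := 1) (fun _ => by positivity) fun u => ?_
  let N := u.sup (fun k => Finset.univ.sup k) + 1
  have hu : u ⊆ Fintype.piFinset fun _ : ι => Finset.range N := by
    intro k hk
    refine Fintype.mem_piFinset.2 fun i => Finset.mem_range.2 (Nat.lt_succ_of_le ?_)
    exact (Finset.le_sup (f := k) (Finset.mem_univ i)).trans
      (Finset.le_sup (f := fun k : ι → ℕ => Finset.univ.sup k) hk)
  refine (Finset.sum_le_sum_of_subset_of_nonneg hu fun _ _ _ => by positivity).trans ?_
  simp only [coherentCoeff_norm_sq]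
  rw [← Finset.prod_univ_sum (fun _ : ι => Finset.range N)
    (fun i j => Real.exp (-‖α i‖ ^ 2) * ((‖α i‖ ^ 2) ^ j / (j.factorial : ℝ)))]
  refine Finset.prod_le_one (fun i _ => Finset.sum_nonneg fun _ _ => by positivity) fun i _ => ?_
  rw [← Finset.mul_sum]
  calc _ ≤ Real.exp (-‖α i‖ ^ 2) * Real.exp (‖α i‖ ^ 2) := by
        gcongr
        exact Real.sum_le_exp_of_nonneg (by positivity) N
    _ = 1 := by rw [← Real.exp_add]; simp

/-- The (product) coherent state `|α⟩`. -/
def coherentState {ι : Type*} [Fintype ι] (α : ι → ℂ) : Fock ι :=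
  ⟨coherentCoeff α, memlp_two (coherentCoeff_summable α)⟩

/-- `ρ` is a pure coherent state `|β⟩⟨β|`. -/
def IsCoherent {ι : Type*} [Fintype ι] (ρ : Fock ι →L[ℂ] Fock ι) : Prop :=
  ∃ β : ι → ℂ, ∀ φ ψ : Fock ι,
    inner ℂ φ (ρ ψ) = inner ℂ φ (coherentState β) * inner ℂ (coherentState β) ψ

/-- `ρ` is a classical state: `ρ = ∫ |β⟩⟨β| dP(β)` (as a weak integral) for a probability
measure `P` on the space of amplitudes. -/
def IsClassical {ι : Type*} [Fintype ι] (ρ : Fock ι →L[ℂ] Fock ι) : Prop :=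
  ∃ P : MeasureTheory.Measure (ι → ℂ), MeasureTheory.IsProbabilityMeasure P ∧
    ∀ φ ψ : Fock ι, inner ℂ φ (ρ ψ)
      = ∫ β, inner ℂ φ (coherentState β) * inner ℂ (coherentState β) ψ ∂P

/-! ### Passive linear unitaries -/

/-- The annihilation operator `a i`, acting on amplitudes in the number basis:
`(a i ψ)(k) = √(k i + 1) ψ(k + e_i)`. -/
def annihilate {ι : Type*} [DecidableEq ι] (i : ι) (ψ : (ι → ℕ) → ℂ) : (ι → ℕ) → ℂ :=
  fun k => ((Real.sqrt ((k i : ℝ) + 1) : ℝ) : ℂ) * ψ (k + Pi.single i 1)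

/-- A unitary `U` from the input modes `ι` to the output modes `κ` is passive linear if it
conserves the total number of particles and transforms the mode operators linearly, by a unitary
matrix `u`: `a i ∘ U = U ∘ ∑ j, u i j • a j` on number states (recall
`a j |k⟩ = √(k j) |k - e_j⟩`, which is `0` if `k j = 0`). -/
def IsPassiveLinear {ι κ : Type*} [Fintype ι] [Fintype κ] [DecidableEq ι] [DecidableEq κ]
    (U : Fock ι ≃ₗᵢ[ℂ] Fock κ) : Prop :=
  (∀ (k : ι → ℕ) (l : κ → ℕ), ∑ i, k i ≠ ∑ i, l i → U (numberState k) l = 0) ∧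
  ∃ u : Matrix κ ι ℂ, u * uᴴ = 1 ∧ uᴴ * u = 1 ∧
    ∀ (i : κ) (k : ι → ℕ), annihilate i (U (numberState k)) =
      U (∑ j, (u i j * ((Real.sqrt (k j : ℝ) : ℝ) : ℂ)) • numberState (k - Pi.single j 1))

/-! ### Measurements and instruments -/

/-- A positive operator-valued measure with outcomes in `M`; the sum converges strongly. -/
def IsPOVM {ι M : Type*} (E : M → Fock ι →L[ℂ] Fock ι) : Prop :=
  (∀ m, (E m).IsPositive) ∧ ∀ ψ, HasSum (fun m => E m ψ) ψ

/-- A family, indexed by measurement outcomes `m : M`, of linear maps from the trace class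
operators on `n` modes to those on `n'` modes. (Complete positivity of each map and trace
preservation of their sum are automatic for the families in the classes below.) -/
abbrev Instrument (M : Type*) (n n' : ℕ) : Type _ :=
  M → traceClass (Fin n) →ₗ[ℂ] traceClass (Fin n')

/-- The maps of `I` are `ρ ↦ tr_{A'} [E m (U (ρ ⊗ σ) U†)]`: an ancilla of `r` modes in the state
`σ` is added, `U` is applied, and the last `q` output modes `A'` are measured with `E` and
discarded. -/
def IsRealizedBy {M : Type*} {n n' r q : ℕ} (I : Instrument M n n')
    (σ : Fock (Fin r) →L[ℂ] Fock (Fin r))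
    (U : Fock (Fin n ⊕ Fin r) ≃ₗᵢ[ℂ] Fock (Fin n' ⊕ Fin q))
    (E : M → Fock (Fin q) →L[ℂ] Fock (Fin q)) : Prop :=
  ∀ (m : M) (ρ : traceClass (Fin n)),
    IsPartialTrace
      (onRight (Fin n') (E m) ∘L (U : Fock (Fin n ⊕ Fin r) →L[ℂ] Fock (Fin n' ⊕ Fin q)) ∘L
        tensor (ρ : Fock (Fin n) →L[ℂ] Fock (Fin n)) σ ∘L
        (U.symm : Fock (Fin n' ⊕ Fin q) →L[ℂ] Fock (Fin n ⊕ Fin r)))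
      (I m ρ : Fock (Fin n') →L[ℂ] Fock (Fin n'))

/-- The instruments in `𝒫₁` that can be realized with exactly `r` ancilla modes: classical
ancilla, passive linear unitary, measurement of the modes to be discarded. -/
def P1With (M : Type*) (n n' r : ℕ) : Set (Instrument M n n') :=
  {I | ∃ (q : ℕ) (σ : Fock (Fin r) →L[ℂ] Fock (Fin r))
      (U : Fock (Fin n ⊕ Fin r) ≃ₗᵢ[ℂ] Fock (Fin n' ⊕ Fin q))
      (E : M → Fock (Fin q) →L[ℂ] Fock (Fin q)),
      IsClassical σ ∧ IsPassiveLinear U ∧ IsPOVM E ∧ IsRealizedBy I σ U E}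

/-- The same with the ancilla in a pure coherent state. -/
def P1CoherentWith (M : Type*) (n n' r : ℕ) : Set (Instrument M n n') :=
  {I | ∃ (q : ℕ) (σ : Fock (Fin r) →L[ℂ] Fock (Fin r))
      (U : Fock (Fin n ⊕ Fin r) ≃ₗᵢ[ℂ] Fock (Fin n' ⊕ Fin q))
      (E : M → Fock (Fin q) →L[ℂ] Fock (Fin q)),
      IsCoherent σ ∧ IsPassiveLinear U ∧ IsPOVM E ∧ IsRealizedBy I σ U E}

/-- The class `𝒫₁` of instruments from `n` to `n'` modes, with any number of ancilla modes. -/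
def P1 (M : Type*) (n n' : ℕ) : Set (Instrument M n n') := ⋃ r, P1With M n n' r

/-- `I` is the classical mixture `∫ J γ dμ(γ)` of the instruments `J γ` (a weak integral): `γ` is
drawn from `μ`, `J γ` is performed, and `γ` is forgotten. -/
def IsMixture {M Γ : Type*} [MeasurableSpace Γ] {n n' : ℕ} (μ : MeasureTheory.Measure Γ)
    (J : Γ → Instrument M n n') (I : Instrument M n n') : Prop :=
  ∀ (m : M) (ρ : traceClass (Fin n)) (φ ψ : Fock (Fin n')),
    MeasureTheory.Integrable
      (fun γ => inner ℂ φ ((J γ m ρ : Fock (Fin n') →L[ℂ] Fock (Fin n')) ψ)) μ ∧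
    inner ℂ φ ((I m ρ : Fock (Fin n') →L[ℂ] Fock (Fin n')) ψ)
      = ∫ γ, inner ℂ φ ((J γ m ρ : Fock (Fin n') →L[ℂ] Fock (Fin n')) ψ) ∂μ

/-- The classical mixtures of instruments in `𝒫₁` that all use the same passive linear unitary,
with `r` ancilla modes; only the classical ancilla state and the measurement depend on the
classical random variable. -/
def P1MixtureWith (M : Type*) (n n' r : ℕ) : Set (Instrument M n n') :=
  {I | ∃ (q : ℕ) (U : Fock (Fin n ⊕ Fin r) ≃ₗᵢ[ℂ] Fock (Fin n' ⊕ Fin q))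
      (Γ : Type) (_ : MeasurableSpace Γ) (μ : MeasureTheory.Measure Γ)
      (σ : Γ → Fock (Fin r) →L[ℂ] Fock (Fin r))
      (E : Γ → M → Fock (Fin q) →L[ℂ] Fock (Fin q))
      (J : Γ → Instrument M n n'),
      IsPassiveLinear U ∧ MeasureTheory.IsProbabilityMeasure μ ∧
      (∀ γ, IsClassical (σ γ) ∧ IsPOVM (E γ) ∧ IsRealizedBy (J γ) (σ γ) U (E γ)) ∧
      IsMixture μ J I}

end Bosonic

end

noncomputable section

namespace Bosonic

/-! ### Number states -/

section NumberStates

variable {ι κ : Type*}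

/-! The argument is linear algebra on coherent amplitudes, lifted to Fock space. Write the unitary
matrix of `U` in blocks P, Q, R, S, where Q takes the ancilla amplitude β to the n' kept outputs.
Only the component of β orthogonal to ker Q reaches those outputs, and that component lives in
dimension rank Q ≤ n'. The rest, β in ker Q, is carried isometrically by S into the discarded modes,
onto a subspace orthogonal to everything else arriving there. Removing this subspace leaves a
smaller unitary u' with at most n' ancilla modes, and u(α, β) = (x, W y + B β) with (x, y) = u'(α, V
β), W an isometry, and B β orthogonal to the range of W (`exists_reduced_unitary`).

On Fock space, |y⟩ ↦ |W y + B β⟩ preserves inner products of coherent states, so it extends to an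
isometry L_β. Coherent states span a dense subspace, hence U(x ⊗ |β⟩) = c (1 ⊗ L_β) U'(x ⊗ |V β⟩)
for all x, with a phase c. Under the partial trace, L_β moves onto the measurement, replacing E by
the POVM L_β† E L_β (`exists_reduction`).

A coherent ancilla has a single β, which gives (3). A classical ancilla is a mixture over β, but the
new measurement depends on β, so in general β must be kept as a classical random variable; this
gives (1). With one outcome, L_β† L_β = 1 does not depend on β, and the mixture is absorbed into the
new ancilla state; this gives (2).

The analytic part consists of two facts. `exists_partialTrace` gives partial traces for coherent
ancillas with bounds uniform in β, and `hasSum_entry_integral` uses these bounds to exchange the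
trace with the integral over β. -/

theorem numberState_self (k : ι → ℕ) : numberState k k = (1 : ℂ) := by
  classical
  rw [numberState, lp.single_apply_self]

theorem numberState_of_ne {k l : ι → ℕ} (h : l ≠ k) : numberState k l = (0 : ℂ) := by
  classical
  rw [numberState, lp.single_apply_ne _ _ _ h]

theorem numberState_apply [DecidableEq (ι → ℕ)] (k l : ι → ℕ) :
    numberState k l = if l = k then (1 : ℂ) else 0 := by
  split_ifs with h
  · rw [h, numberState_self]
  · exact numberState_of_ne h

theorem inner_numberState_left (k : ι → ℕ) (ψ : Fock ι) : inner ℂ (numberState k) ψ = ψ k := by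
  classical
  rw [numberState, lp.inner_single_left]
  simp

theorem inner_numberState_right (k : ι → ℕ) (ψ : Fock ι) :
    inner ℂ ψ (numberState k) = star (ψ k) := by
  rw [← inner_conj_symm, inner_numberState_left]; rfl

theorem norm_numberState (k : ι → ℕ) : ‖(numberState k : Fock ι)‖ = 1 := by
  classical
  rw [numberState, lp.norm_single (by simp)]
  simp

theorem hasSum_numberState (ψ : Fock ι) : HasSum (fun k => ψ k • numberState k) ψ := by
  classical
  convert lp.hasSum_single (by simp) ψ using 2 with k
  ext l
  rw [lp.coeFn_smul, Pi.smul_apply, numberState_apply, lp.single_apply]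
  by_cases h : l = k
  · subst h; simp
  · simp [h]

theorem entry_eq_inner (T : Fock ι →L[ℂ] Fock ι) (k l : ι → ℕ) :
    entry T k l = inner ℂ (numberState k) (T (numberState l)) :=
  (inner_numberState_left _ _).symm

/-- Bounded operators that agree on number states are equal. -/
theorem clm_ext_numberState {H : Type*} [NormedAddCommGroup H] [NormedSpace ℂ H]
    {S T : Fock ι →L[ℂ] H} (h : ∀ k, S (numberState k) = T (numberState k)) : S = T := by
  ext1 ψ
  have hS := (hasSum_numberState ψ).mapL S
  have hT := (hasSum_numberState ψ).mapL T
  simp only [map_smul, h] at hS hT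
  exact hS.unique hT

theorem entry_ext {S T : Fock ι →L[ℂ] Fock ι} (h : ∀ k l, entry S k l = entry T k l) : S = T :=
  clm_ext_numberState fun l => by ext k; exact h k l

@[simp] theorem entry_add (S T : Fock ι →L[ℂ] Fock ι) (k l : ι → ℕ) :
    entry (S + T) k l = entry S k l + entry T k l := rfl

@[simp] theorem entry_smul (c : ℂ) (T : Fock ι →L[ℂ] Fock ι) (k l : ι → ℕ) :
    entry (c • T) k l = c * entry T k l := rfl

theorem norm_entry_le (T : Fock ι →L[ℂ] Fock ι) (k l : ι → ℕ) : ‖entry T k l‖ ≤ ‖T‖ := by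
  rw [entry_eq_inner]
  refine (norm_inner_le_norm _ _).trans ?_
  rw [norm_numberState, one_mul]
  simpa [norm_numberState] using T.le_opNorm (numberState l)

/-- Evaluation at a point as a bounded linear functional. -/
def evalCLM {X : Type*} (x : X) : L2 X →L[ℂ] ℂ := lp.evalCLM ℂ (fun _ : X => ℂ) 2 x

@[simp] theorem evalCLM_apply {X : Type*} (x : X) (ψ : L2 X) : evalCLM x ψ = ψ x := rfl

end NumberStates

/-! ### Slices and operators on tensor factors -/

section Slices

variable {X Y Z : Type*} {ι κ : Type*}

theorem norm_slice_le (e : Y × X ≃ Z) (ψ : L2 Z) (y : Y) : ‖slice e ψ y‖ ≤ ‖ψ‖ := by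
  have h := le_hasSum (hasSum_norm_slice e ψ) y fun _ _ => by positivity
  exact le_of_sq_le_sq h (norm_nonneg _)

/-- `slice` at a fixed index as a bounded linear map. -/
def sliceCLM (e : Y × X ≃ Z) (y : Y) : L2 Z →L[ℂ] L2 X :=
  LinearMap.mkContinuous
    { toFun := fun ψ => slice e ψ y
      map_add' := fun _ _ => by ext; rfl
      map_smul' := fun _ _ => by ext; rfl } 1 fun ψ => by
    simpa using norm_slice_le e ψ y

theorem slice_amplify (e : Y × X ≃ Z) (T : L2 X →L[ℂ] L2 X) (ψ : L2 Z) (y : Y) :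
    slice e (amplify e T ψ) y = T (slice e ψ y) := by
  ext x
  change T (slice e ψ (e.symm (e (y, x))).1) (e.symm (e (y, x))).2 = _
  rw [e.symm_apply_apply]

theorem amplify_apply (e : Y × X ≃ Z) (T : L2 X →L[ℂ] L2 X) (ψ : L2 Z) (y : Y) (x : X) :
    amplify e T ψ (e (y, x)) = T (slice e ψ y) x := by
  rw [← slice_amplify]; rfl

/-- The vector `⟨s| ψ` of the modes `κ`, for `ψ` in the modes `ι ⊕ κ`. -/
def row (s : ι → ℕ) : Fock (ι ⊕ κ) →L[ℂ] Fock κ := sliceCLM (splitLeft ι κ) s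

/-- The vector `⟨a| ψ` of the modes `ι`, for `ψ` in the modes `ι ⊕ κ`. -/
def col (a : κ → ℕ) : Fock (ι ⊕ κ) →L[ℂ] Fock ι := sliceCLM (splitRight ι κ) a

@[simp] theorem row_apply (s : ι → ℕ) (ψ : Fock (ι ⊕ κ)) (a : κ → ℕ) :
    row s ψ a = ψ (Sum.elim s a) := rfl

@[simp] theorem col_apply (a : κ → ℕ) (ψ : Fock (ι ⊕ κ)) (s : ι → ℕ) :
    col a ψ s = ψ (Sum.elim s a) := rfl

theorem hasSum_norm_col (ψ : Fock (ι ⊕ κ)) : HasSum (fun a => ‖col a ψ‖ ^ 2) (‖ψ‖ ^ 2) :=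
  hasSum_norm_slice (splitRight ι κ) ψ

theorem norm_row_le (s : ι → ℕ) (ψ : Fock (ι ⊕ κ)) : ‖row s ψ‖ ≤ ‖ψ‖ :=
  norm_slice_le (splitLeft ι κ) ψ s

theorem row_onRight (T : Fock κ →L[ℂ] Fock κ) (s : ι → ℕ) (ψ : Fock (ι ⊕ κ)) :
    row s (onRight ι T ψ) = T (row s ψ) :=
  slice_amplify (splitLeft ι κ) T ψ s

theorem sumElim_surjective (z : ι ⊕ κ → ℕ) : ∃ s a, z = Sum.elim s a :=
  ⟨z ∘ Sum.inl, z ∘ Sum.inr, (Sum.elim_comp_inl_inr z).symm⟩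

theorem sumElim_inj {A : Type*} {s t : ι → A} {a b : κ → A} :
    Sum.elim s a = Sum.elim t b ↔ s = t ∧ a = b := by
  constructor
  · intro h
    exact ⟨funext fun i => congrFun h (Sum.inl i), funext fun i => congrFun h (Sum.inr i)⟩
  · rintro ⟨rfl, rfl⟩; rfl

theorem onRight_apply (T : Fock κ →L[ℂ] Fock κ) (ψ : Fock (ι ⊕ κ)) (s : ι → ℕ) (a : κ → ℕ) :
    onRight ι T ψ (Sum.elim s a) = T (row s ψ) a :=
  amplify_apply (splitLeft ι κ) T ψ s a

theorem onLeft_apply (T : Fock ι →L[ℂ] Fock ι) (ψ : Fock (ι ⊕ κ)) (s : ι → ℕ) (a : κ → ℕ) :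
    onLeft κ T ψ (Sum.elim s a) = T (col a ψ) s :=
  amplify_apply (splitRight ι κ) T ψ a s

theorem entry_tensor (T : Fock ι →L[ℂ] Fock ι) (T' : Fock κ →L[ℂ] Fock κ)
    (s t : ι → ℕ) (a b : κ → ℕ) :
    entry (tensor T T') (Sum.elim s a) (Sum.elim t b) = entry T s t * entry T' a b := by
  classical
  change onLeft κ T (onRight ι T' (numberState (Sum.elim t b))) (Sum.elim s a) = _
  rw [onLeft_apply]
  have h : col a (onRight ι T' (numberState (Sum.elim t b))) = entry T' a b • numberState t := by
    ext s'
    rw [col_apply, onRight_apply]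
    have h2 : row s' (numberState (Sum.elim t b) : Fock (ι ⊕ κ))
        = (if s' = t then (1 : ℂ) else 0) • numberState b := by
      ext a'
      simp only [row_apply, numberState_apply, sumElim_inj, lp.coeFn_smul, Pi.smul_apply,
        smul_eq_mul]
      by_cases h1 : s' = t <;> simp [h1]
    rw [h2, map_smul]
    simp only [numberState_apply, lp.coeFn_smul, Pi.smul_apply, smul_eq_mul, entry]
    ring
  rw [h, map_smul]
  simp only [lp.coeFn_smul, Pi.smul_apply, smul_eq_mul, entry]
  ring

end Slices

/-! ### Power series in several variables -/

section PowerSeries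

variable {ι : Type*} [Fintype ι]

/-- The coefficients of an everywhere convergent power series that vanishes identically
are zero. -/
theorem eq_zero_of_hasSum_monomial {c : (ι → ℕ) → ℂ}
    (h : ∀ α : ι → ℂ, HasSum (fun k => c k * ∏ i, α i ^ k i) 0) : c = 0 := by
  classical
  -- On the complex line z ↦ z w the series becomes a one-variable power series whose coefficients
  -- are the homogeneous parts at w; uniqueness in one variable kills each of them.
  have h1 : ∀ (m : ℕ) (w : ι → ℂ),
      ∑ k ∈ Finset.piAntidiag Finset.univ m, c k * ∏ i, w i ^ k i = 0 := by
    intro m w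
    let p : FormalMultilinearSeries ℂ ℂ ℂ := FormalMultilinearSeries.ofScalars ℂ fun m =>
      ∑ k ∈ Finset.piAntidiag Finset.univ m, c k * ∏ i, w i ^ k i
    have hp : HasFPowerSeriesAt (fun _ : ℂ => (0 : ℂ)) p 0 := by
      rw [hasFPowerSeriesAt_iff]
      refine Filter.Eventually.of_forall fun z => ?_
      have h2 := (h fun i => z * w i).tsum_fiberwise fun k => ∑ i, k i
      convert h2 using 2 with n
      have hset : (fun k : ι → ℕ => ∑ i, k i) ⁻¹' {n}
          = ↑(Finset.piAntidiag (Finset.univ : Finset ι) n) := by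
        ext k; simp
      rw [hset, Finset.tsum_subtype' (Finset.piAntidiag (Finset.univ : Finset ι) n)
        (fun k => c k * ∏ i, (z * w i) ^ k i)]
      simp only [p, FormalMultilinearSeries.coeff_ofScalars, smul_eq_mul, Finset.mul_sum]
      refine Finset.sum_congr rfl fun k hk => ?_
      have hk' : ∑ i, k i = n := by simpa using hk
      simp only [mul_pow, Finset.prod_mul_distrib, Finset.prod_pow_eq_pow_sum, hk']
      ring
    have h3 := hp.eq_zero
    have h4 := congrArg (fun q : FormalMultilinearSeries ℂ ℂ ℂ => q.coeff m) h3
    have h5 : (0 : FormalMultilinearSeries ℂ ℂ ℂ).coeff m = 0 := by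
      simp [FormalMultilinearSeries.coeff]
    simpa only [p, FormalMultilinearSeries.coeff_ofScalars, h5] using h4
  funext k
  -- The homogeneous part of degree ∑ k i is a polynomial that vanishes at every point, so it is
  -- zero.
  let P : MvPolynomial ι ℂ := ∑ l ∈ Finset.piAntidiag Finset.univ (∑ i, k i),
    MvPolynomial.monomial (Finsupp.equivFunOnFinite.symm l) (c l)
  have hP : P = 0 := by
    refine MvPolynomial.funext fun w => ?_
    rw [map_sum, map_zero, ← h1 (∑ i, k i) w]
    refine Finset.sum_congr rfl fun l _ => ?_
    rw [MvPolynomial.eval_monomial, Finsupp.prod_fintype _ _ (by simp)]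
    rfl
  have h5 := congrArg (MvPolynomial.coeff (Finsupp.equivFunOnFinite.symm k)) hP
  simp only [P, MvPolynomial.coeff_sum, MvPolynomial.coeff_monomial, MvPolynomial.coeff_zero,
    EmbeddingLike.apply_eq_iff_eq] at h5
  rw [Finset.sum_ite_eq' _ k] at h5
  simpa using h5

end PowerSeries

/-! ### Coherent states -/

section Coherent

variable {ι κ : Type*} [Fintype ι] [Fintype κ]

/-- The normalization `∏ i, √(k i)!`. -/
def sqrtFactorial (k : ι → ℕ) : ℂ := ∏ i, ((Real.sqrt ((k i).factorial : ℝ) : ℝ) : ℂ)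

theorem sqrtFactorial_ne_zero (k : ι → ℕ) : sqrtFactorial k ≠ 0 := by
  refine Finset.prod_ne_zero_iff.2 fun i _ => ?_
  exact_mod_cast (Real.sqrt_pos.2 (by positivity)).ne'

/-- The vacuum amplitude of a coherent state. -/
def vacuumAmplitude (α : ι → ℂ) : ℂ := Complex.exp (-(star α ⬝ᵥ α) / 2)

theorem vacuumAmplitude_ne_zero (α : ι → ℂ) : vacuumAmplitude α ≠ 0 := Complex.exp_ne_zero _

theorem star_dotProduct_self (α : ι → ℂ) : star α ⬝ᵥ α = ((∑ i, ‖α i‖ ^ 2 : ℝ) : ℂ) := by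
  simp only [dotProduct, Pi.star_apply, RCLike.star_def, Complex.conj_mul']
  push_cast
  rfl

theorem coherentCoeff_eq (α : ι → ℂ) (k : ι → ℕ) :
    coherentCoeff α k = vacuumAmplitude α * (∏ i, α i ^ k i) / sqrtFactorial k := by
  rw [coherentCoeff, vacuumAmplitude, star_dotProduct_self, sqrtFactorial, Finset.prod_div_distrib,
    Finset.prod_mul_distrib]
  congr 2
  rw [← Complex.ofReal_prod, ← Real.exp_sum, Complex.ofReal_exp]
  congr 1
  push_cast
  rw [← Finset.sum_neg_distrib, Finset.sum_div]

@[simp] theorem coherentState_apply (α : ι → ℂ) (k : ι → ℕ) :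
    coherentState α k = coherentCoeff α k := rfl

theorem coherentState_sumElim (α : ι → ℂ) (β : κ → ℂ) (s : ι → ℕ) (a : κ → ℕ) :
    coherentState (Sum.elim α β) (Sum.elim s a) = coherentState α s * coherentState β a := by
  simp only [coherentState_apply, coherentCoeff, Fintype.prod_sum_type, Sum.elim_inl, Sum.elim_inr]

theorem row_coherentState (α : ι → ℂ) (β : κ → ℂ) (s : ι → ℕ) :
    row s (coherentState (Sum.elim α β)) = coherentState α s • coherentState β := by
  ext a
  rw [row_apply, coherentState_sumElim]; rfl

/-- Up to the nonzero vacuum amplitude, ⟨ψ|α⟩ is an everywhere convergent power series in α, with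
coefficients that are nonzero multiples of the conjugates of `ψ k`. -/
theorem eq_zero_of_inner_coherentState {ψ : Fock ι}
    (h : ∀ α, inner ℂ ψ (coherentState α) = 0) : ψ = 0 := by
  have key : (fun k => star (ψ k) / sqrtFactorial k) = 0 := by
    refine eq_zero_of_hasSum_monomial fun α => ?_
    have h1 : HasSum (fun k => inner ℂ (ψ k) (coherentState α k)) (inner ℂ ψ (coherentState α)) :=
      lp.hasSum_inner ψ (coherentState α)
    rw [h α] at h1
    have h2 := h1.mul_left (vacuumAmplitude α)⁻¹
    rw [mul_zero] at h2
    refine (congrArg (fun f => HasSum f (0 : ℂ)) (funext fun k => ?_)).mpr h2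
    rw [coherentState_apply, coherentCoeff_eq, RCLike.inner_apply]
    have := vacuumAmplitude_ne_zero α
    have := sqrtFactorial_ne_zero k
    rw [← RCLike.star_def]
    field_simp
  ext k
  have h3 := congrFun key k
  simpa [sqrtFactorial_ne_zero] using h3

theorem span_coherentState_dense :
    Dense (Submodule.span ℂ (Set.range (coherentState (ι := ι))) : Set (Fock ι)) := by
  rw [Submodule.dense_iff_topologicalClosure_eq_top, Submodule.topologicalClosure_eq_top_iff,
    Submodule.eq_bot_iff]
  intro ψ hψ
  refine eq_zero_of_inner_coherentState fun α => ?_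
  exact Submodule.inner_left_of_mem_orthogonal (Submodule.subset_span (Set.mem_range_self α)) hψ

/-- Bounded operators that agree on coherent states are equal. -/
theorem clm_ext_coherentState {H : Type*} [NormedAddCommGroup H] [NormedSpace ℂ H]
    {S T : Fock ι →L[ℂ] H} (h : ∀ α, S (coherentState α) = T (coherentState α)) : S = T :=
  ContinuousLinearMap.ext_on span_coherentState_dense (Set.eqOn_range.2 (funext h))

/-- Sums over multi-indices can be evaluated along boxes, where they factor into products of
one-mode sums. -/
theorem tendsto_box_atTop [DecidableEq ι] : Filter.Tendsto
    (fun N => Fintype.piFinset fun _ : ι => Finset.range N) Filter.atTop Filter.atTop := by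
  refine Filter.tendsto_atTop_finset_of_monotone ?_ ?_
  · intro M N hMN
    exact Fintype.piFinset_subset _ _ fun _ => Finset.range_mono hMN
  · intro k
    refine ⟨Finset.univ.sup k + 1, Fintype.mem_piFinset.2 fun i => Finset.mem_range.2 ?_⟩
    exact Nat.lt_succ_of_le (Finset.le_sup (Finset.mem_univ i))

theorem inner_coherentState (α β : ι → ℂ) :
    inner ℂ (coherentState α) (coherentState β)
      = vacuumAmplitude α * vacuumAmplitude β * Complex.exp (star α ⬝ᵥ β) := by
  classical
  have h1 : HasSum (fun k => inner ℂ (coherentState α k) (coherentState β k))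
      (inner ℂ (coherentState α) (coherentState β)) :=
    lp.hasSum_inner _ _
  have hterm : ∀ k : ι → ℕ, inner ℂ (coherentState α k) (coherentState β k)
      = vacuumAmplitude α * vacuumAmplitude β
        * ∏ i, (star (α i) * β i) ^ k i / ((k i).factorial : ℂ) := by
    intro k
    rw [RCLike.inner_apply, coherentState_apply, coherentState_apply, coherentCoeff_eq,
      coherentCoeff_eq]
    have hv : star (vacuumAmplitude α) = vacuumAmplitude α := by
      rw [vacuumAmplitude, star_dotProduct_self, RCLike.star_def, ← Complex.exp_conj, map_div₀,
        map_neg, Complex.conj_ofReal, Complex.conj_ofNat]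
    have hf : star (sqrtFactorial k) = sqrtFactorial k := by
      simp [sqrtFactorial]
    have hff : sqrtFactorial k * sqrtFactorial k = ∏ i, ((k i).factorial : ℂ) := by
      rw [sqrtFactorial, ← Finset.prod_mul_distrib]
      refine Finset.prod_congr rfl fun i _ => ?_
      rw [← Complex.ofReal_mul, Real.mul_self_sqrt (by positivity)]
      norm_cast
    rw [Finset.prod_div_distrib, ← hff]
    simp only [mul_pow, Finset.prod_mul_distrib, ← RCLike.star_def, star_div₀, star_mul', hv, hf,
      star_prod, star_pow]
    field_simp
  simp only [hterm] at h1
  have h2 := h1.comp tendsto_box_atTop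
  refine tendsto_nhds_unique h2 ?_
  have h3 : ∀ N : ℕ, ∑ k ∈ Fintype.piFinset (fun _ : ι => Finset.range N),
      vacuumAmplitude α * vacuumAmplitude β
        * ∏ i, (star (α i) * β i) ^ k i / ((k i).factorial : ℂ)
      = vacuumAmplitude α * vacuumAmplitude β
        * ∏ i, ∑ j ∈ Finset.range N, (star (α i) * β i) ^ j / (j.factorial : ℂ) := by
    intro N
    rw [← Finset.mul_sum, Finset.prod_univ_sum (fun _ : ι => Finset.range N)
      (fun i j => (star (α i) * β i) ^ j / (j.factorial : ℂ))]
  refine Filter.Tendsto.congr (fun N => (h3 N).symm) ?_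
  refine Filter.Tendsto.const_mul _ ?_
  have h4 : Complex.exp (star α ⬝ᵥ β) = ∏ i, Complex.exp (star (α i) * β i) := by
    rw [dotProduct, Complex.exp_sum]; rfl
  rw [h4]
  refine tendsto_finsetProd _ fun i _ => ?_
  have h5 := NormedSpace.expSeries_div_hasSum_exp (star (α i) * β i)
  rw [← Complex.exp_eq_exp_ℂ] at h5
  exact h5.tendsto_sum_nat

theorem norm_coherentState (α : ι → ℂ) : ‖coherentState α‖ = 1 := by
  have h := inner_coherentState α α
  rw [vacuumAmplitude, ← Complex.exp_add, ← Complex.exp_add,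
    show -(star α ⬝ᵥ α) / 2 + -(star α ⬝ᵥ α) / 2 + star α ⬝ᵥ α = 0 by ring, Complex.exp_zero,
    inner_self_eq_norm_sq_to_K] at h
  have h2 : ((‖coherentState α‖ ^ 2 : ℝ) : ℂ) = 1 := by
    rw [← h]; push_cast; rfl
  have h3 : ‖coherentState α‖ ^ 2 = 1 := by exact_mod_cast h2
  exact (pow_eq_one_iff_of_nonneg (norm_nonneg _) two_ne_zero).1 h3

/-- For unit vectors the squared distance is 2 - 2 Re of the inner product, which is explicit and
continuous here. -/
theorem continuous_coherentState : Continuous (coherentState (ι := ι)) := by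
  rw [continuous_iff_continuousAt]
  intro α
  have h1 : ∀ β, ‖coherentState β - coherentState α‖ ^ 2
      = 2 - 2 * (inner ℂ (coherentState β) (coherentState α)).re := by
    intro β
    rw [@norm_sub_sq ℂ, norm_coherentState, norm_coherentState]
    simp only [RCLike.re_to_complex]
    ring
  have h2 : Continuous fun β => ‖coherentState β - coherentState α‖ ^ 2 := by
    simp only [h1, inner_coherentState, vacuumAmplitude, dotProduct, Pi.star_apply]
    fun_prop
  have h3 : Continuous fun β => ‖coherentState β - coherentState α‖ := by
    have := h2.sqrt
    simpa using this
  rw [ContinuousAt, tendsto_iff_norm_sub_tendsto_zero]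
  simpa using h3.tendsto α

/-- An isometry can be defined by its values on coherent states, if they have the right
inner products. -/
theorem exists_isometry_coherentState {H : Type*} [NormedAddCommGroup H] [InnerProductSpace ℂ H]
    [CompleteSpace H] (f : (ι → ℂ) → H)
    (hf : ∀ α β, inner ℂ (f α) (f β) = inner ℂ (coherentState α) (coherentState β)) :
    ∃ L : Fock ι →ₗᵢ[ℂ] H, ∀ α, L (coherentState α) = f α := by
  -- Formal combinations avoid any question of linear dependence among coherent states: equal Gram
  -- matrices make `g x` and `e x` equal in norm, so `g` factors through `e` and extends from its
  -- dense range.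
  let e := Finsupp.linearCombination ℂ (coherentState (ι := ι))
  let g := Finsupp.linearCombination ℂ f
  have hin : ∀ x y, inner ℂ (g x) (g y) = inner ℂ (e x) (e y) := by
    intro x y
    simp only [g, e, Finsupp.linearCombination_apply, Finsupp.sum, sum_inner, inner_sum,
      inner_smul_left, inner_smul_right, hf]
  have hn : ∀ x, ‖g x‖ = ‖e x‖ := by
    intro x
    rw [@norm_eq_sqrt_re_inner ℂ, @norm_eq_sqrt_re_inner ℂ, hin]
  have hd : DenseRange e := by
    have := span_coherentState_dense (ι := ι)
    rw [← Finsupp.range_linearCombination] at this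
    exact this
  have hb : ∃ C, ∀ x, ‖g x‖ ≤ C * ‖e x‖ := ⟨1, fun x => by rw [hn, one_mul]⟩
  let T := g.extendOfNorm e
  have hT : ∀ x, T (e x) = g x := LinearMap.extendOfNorm_eq hd hb
  refine ⟨⟨T.toLinearMap, fun ψ => ?_⟩, fun α => ?_⟩
  · refine hd.induction_on (p := fun ψ => ‖T ψ‖ = ‖ψ‖) ψ
      (isClosed_eq (by fun_prop) (by fun_prop)) fun x => ?_
    rw [hT, hn]
  · have := hT (Finsupp.single α 1)
    simpa [e, g] using this

end Coherent

/-! ### Passive linear unitaries and coherent states -/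

theorem _root_.HasSum.of_eq {X A : Type*} [AddCommMonoid A] [TopologicalSpace A] {f g : X → A}
    {a b : A} (h : HasSum f a) (hfg : ∀ x, g x = f x) (hab : b = a) : HasSum g b := by
  rw [funext hfg, hab]; exact h

section Passive

variable {ι κ : Type*} [Fintype ι]

theorem sqrtFactorial_add_single [DecidableEq ι] (k : ι → ℕ) (i : ι) :
    sqrtFactorial (k + Pi.single i 1)
      = ((Real.sqrt ((k i : ℝ) + 1) : ℝ) : ℂ) * sqrtFactorial k := by
  have h : ∀ j, ((Real.sqrt (((k + Pi.single i 1 : ι → ℕ) j).factorial : ℝ) : ℝ) : ℂ)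
      = (if j = i then ((Real.sqrt ((k i : ℝ) + 1) : ℝ) : ℂ) else 1)
        * ((Real.sqrt ((k j).factorial : ℝ) : ℝ) : ℂ) := by
    intro j
    by_cases hj : j = i
    · subst hj
      simp [Nat.factorial_succ]
    · simp [hj]
  rw [sqrtFactorial, Finset.prod_congr rfl fun j _ => h j, Finset.prod_mul_distrib]
  simp [sqrtFactorial]

theorem prod_pow_add_single [DecidableEq ι] (α : ι → ℂ) (k : ι → ℕ) (i : ι) :
    ∏ j, α j ^ (k + Pi.single i 1 : ι → ℕ) j = α i * ∏ j, α j ^ k j := by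
  simp only [Pi.add_apply, pow_add, Finset.prod_mul_distrib]
  rw [mul_comm, Finset.prod_eq_single i (fun j _ hj => by simp [hj]) (by simp)]
  simp

theorem sqrt_add_one_ne_zero (m : ℕ) : ((Real.sqrt ((m : ℝ) + 1) : ℝ) : ℂ) ≠ 0 := by
  exact_mod_cast (Real.sqrt_pos.2 (by positivity)).ne'

theorem annihilate_coherentState [DecidableEq ι] (i : ι) (α : ι → ℂ) :
    annihilate i (coherentState α) = α i • ⇑(coherentState α) := by
  funext k
  rw [annihilate, Pi.smul_apply, coherentState_apply, coherentState_apply, coherentCoeff_eq,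
    coherentCoeff_eq, sqrtFactorial_add_single, prod_pow_add_single, smul_eq_mul]
  have := sqrt_add_one_ne_zero (k i)
  have := sqrtFactorial_ne_zero k
  field_simp

/-- Simultaneous eigenvectors of the annihilation operators are multiples of coherent states. -/
theorem eq_of_annihilate_eq_smul [DecidableEq ι] {ψ : (ι → ℕ) → ℂ} {α : ι → ℂ}
    (h : ∀ i, annihilate i ψ = α i • ψ) (k : ι → ℕ) :
    ψ k = ψ 0 * (∏ i, α i ^ k i) / sqrtFactorial k := by
  induction hn : ∑ i, k i generalizing k with
  | zero =>
    have hk : k = 0 := by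
      funext i
      exact (Finset.sum_eq_zero_iff.1 hn) i (Finset.mem_univ i)
    subst hk
    simp [sqrtFactorial]
  | succ n ih =>
    -- Removing one particle from an occupied mode i, the eigenvalue equation of `annihilate i` at
    -- the smaller occupation determines `ψ k`.
    obtain ⟨i, hi⟩ : ∃ i, k i ≠ 0 := by
      by_contra! hk
      simp [hk] at hn
    obtain ⟨l, rfl⟩ : ∃ l : ι → ℕ, k = l + Pi.single i 1 := by
      refine ⟨k - Pi.single i 1, funext fun j => ?_⟩
      by_cases hj : j = i
      · subst hj
        simp; omega
      · simp [hj]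
    have hl : ∑ j, l j = n := by
      simp only [Pi.add_apply, Finset.sum_add_distrib, Finset.sum_pi_single', Finset.mem_univ,
        if_true] at hn
      omega
    have h1 := congrFun (h i) l
    rw [annihilate, Pi.smul_apply, smul_eq_mul, ih l hl] at h1
    rw [sqrtFactorial_add_single, prod_pow_add_single]
    have h2 := sqrt_add_one_ne_zero (l i)
    have := sqrtFactorial_ne_zero l
    rw [eq_div_iff (by positivity)]
    calc _ = (((Real.sqrt ((l i : ℝ) + 1) : ℝ) : ℂ) * ψ (l + Pi.single i 1))
          * sqrtFactorial l := by ring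
      _ = _ := by
        rw [h1]
        field_simp

/-- The expansion of `α j • T |α⟩` obtained by applying the annihilation operator termwise. -/
theorem hasSum_annihilate_coherentState [DecidableEq ι] {H : Type*} [NormedAddCommGroup H]
    [NormedSpace ℂ H] (T : Fock ι →L[ℂ] H) (α : ι → ℂ) (j : ι) :
    HasSum (fun k : ι → ℕ => coherentState α k • ((Real.sqrt (k j : ℝ) : ℝ) : ℂ) •
      T (numberState (k - Pi.single j 1))) (α j • T (coherentState α)) := by
  have hinj : Function.Injective fun k : ι → ℕ => k + Pi.single j 1 :=
    add_left_injective (Pi.single j 1 : ι → ℕ)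
  -- Outside the image of k ↦ k + e_j one has k j = 0, so the factor √(k j) removes the terms in
  -- which the subtraction is truncated.
  rw [← hinj.hasSum_iff]
  · have h := ((hasSum_numberState (coherentState α)).mapL T).const_smul (α j)
    refine h.of_eq (fun k => ?_) rfl
    have h1 := congrFun (annihilate_coherentState j α) k
    rw [annihilate, Pi.smul_apply, smul_eq_mul] at h1
    simp only [Function.comp_apply, add_tsub_cancel_right, map_smul, smul_smul]
    rw [← h1]
    simp [mul_comm]
  · intro k hk
    have h0 : k j = 0 := by
      by_contra hne
      refine hk ⟨k - Pi.single j 1, funext fun i => ?_⟩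
      by_cases hi : i = j
      · subst hi
        simp; omega
      · simp [hi]
    simp [h0]

/-- `f ↦ (a i f)(l)` as a bounded functional. -/
def annihilateCLM [DecidableEq κ] (i : κ) (l : κ → ℕ) : Fock κ →L[ℂ] ℂ :=
  ((Real.sqrt ((l i : ℝ) + 1) : ℝ) : ℂ) • evalCLM (l + Pi.single i 1)

/-- Together with `hasSum_annihilate_map`, this passes between the commutation relation on number
states and the eigenvalue equation on coherent states. Everything is evaluated at a fixed `l`, so no
domain of an unbounded operator enters. -/
theorem hasSum_map_sum_annihilate [DecidableEq ι] (T : Fock ι →L[ℂ] Fock κ) (u : Matrix κ ι ℂ) (α : ι → ℂ)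
    (i : κ) (l : κ → ℕ) :
    HasSum (fun k => coherentState α k *
        T (∑ j, (u i j * ((Real.sqrt (k j : ℝ) : ℝ) : ℂ)) • numberState (k - Pi.single j 1)) l)
      ((u *ᵥ α) i * T (coherentState α) l) := by
  have h : ∀ j ∈ (Finset.univ : Finset ι), _ := fun j _ =>
    (hasSum_annihilate_coherentState (evalCLM l ∘L T) α j).mul_left (u i j)
  have h2 := hasSum_sum h
  refine h2.of_eq (fun k => ?_) ?_
  · rw [map_sum]
    have h3 : ∀ ψ : Fock κ, ψ l = evalCLM l ψ := fun _ => rfl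
    rw [h3, map_sum, Finset.mul_sum]
    refine Finset.sum_congr rfl fun j _ => ?_
    simp only [map_smul, smul_eq_mul, ContinuousLinearMap.comp_apply]
    ring
  · change (∑ j, u i j * α j) * _ = _
    rw [Finset.sum_mul]
    refine Finset.sum_congr rfl fun j _ => ?_
    simp only [smul_eq_mul, ContinuousLinearMap.comp_apply, evalCLM_apply]
    ring

theorem hasSum_annihilate_map [DecidableEq κ] (T : Fock ι →L[ℂ] Fock κ) (α : ι → ℂ)
    (i : κ) (l : κ → ℕ) :
    HasSum (fun k => coherentState α k * annihilate i (T (numberState k)) l)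
      (annihilate i (T (coherentState α)) l) := by
  have h := (hasSum_numberState (coherentState α)).mapL (annihilateCLM i l ∘L T)
  exact h.of_eq (fun k => by rw [map_smul, smul_eq_mul]; rfl) rfl

theorem hasSum_map_numberState (T : Fock ι →L[ℂ] Fock κ) (α : ι → ℂ) (l : κ → ℕ) :
    HasSum (fun k => coherentState α k * T (numberState k) l) (T (coherentState α) l) := by
  have h := (hasSum_numberState (coherentState α)).mapL (evalCLM l ∘L T)
  exact h.of_eq (fun k => by rw [map_smul, smul_eq_mul]; rfl) rfl

variable [Fintype κ]

theorem vacuumAmplitude_mulVec [DecidableEq ι] {u : Matrix κ ι ℂ} (hu : uᴴ * u = 1) (α : ι → ℂ) :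
    vacuumAmplitude (u *ᵥ α) = vacuumAmplitude α := by
  rw [vacuumAmplitude, Matrix.star_mulVec, ← Matrix.dotProduct_mulVec, Matrix.mulVec_mulVec, hu,
    Matrix.one_mulVec, vacuumAmplitude]

variable [DecidableEq ι]

/-- A passive linear unitary maps coherent states to coherent states, up to a fixed phase. -/
theorem IsPassiveLinear.exists_coherentState [DecidableEq κ] {U : Fock ι ≃ₗᵢ[ℂ] Fock κ} (hU : IsPassiveLinear U) :
    ∃ (u : Matrix κ ι ℂ) (c : ℂ), u * uᴴ = 1 ∧ uᴴ * u = 1 ∧ ‖c‖ = 1 ∧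
      ∀ α, U (coherentState α) = c • coherentState (u *ᵥ α) := by
  obtain ⟨hN, u, hu1, hu2, hann⟩ := hU
  let T : Fock ι →L[ℂ] Fock κ := U
  have hT : ∀ ψ, T ψ = U ψ := fun _ => rfl
  -- By conservation of particle number only the vacuum contributes to the vacuum component of U|α⟩.
  have hvac : ∀ α, U (coherentState α) 0 = vacuumAmplitude α * U (numberState 0) 0 := by
    intro α
    refine (hasSum_map_numberState T α 0).unique ?_
    have h := hasSum_single (f := fun k => coherentState α k * T (numberState k) 0) 0 ?_
    · rw [coherentState_apply, coherentCoeff_eq] at h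
      simpa [sqrtFactorial, hT] using h
    · intro k hk
      have h0 : ∑ i, k i ≠ ∑ i, (0 : κ → ℕ) i := by
        intro h
        apply hk
        funext i
        simp only [Pi.zero_apply, Finset.sum_const_zero] at h
        exact (Finset.sum_eq_zero_iff.1 h) i (Finset.mem_univ i)
      rw [hT, hN k 0 h0, mul_zero]
  have hmain : ∀ α, U (coherentState α) = U (numberState 0) 0 • coherentState (u *ᵥ α) := by
    intro α
    -- U|α⟩ is a simultaneous eigenvector with eigenvalues u α, hence a multiple of |u α⟩; the
    -- vacuum components fix the factor, the same for all α.
    have heig : ∀ i, annihilate i (U (coherentState α)) = (u *ᵥ α) i • ⇑(U (coherentState α)) := by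
      intro i
      funext l
      refine (hasSum_annihilate_map T α i l).unique ?_
      have h := hasSum_map_sum_annihilate T u α i l
      simp only [hT] at h ⊢
      simpa only [hann, Pi.smul_apply, smul_eq_mul] using h
    ext l
    rw [eq_of_annihilate_eq_smul heig l, hvac, lp.coeFn_smul, Pi.smul_apply, coherentState_apply,
      coherentCoeff_eq, vacuumAmplitude_mulVec hu2, smul_eq_mul]
    ring
  refine ⟨u, U (numberState 0) 0, hu1, hu2, ?_, hmain⟩
  have h := congrArg norm (hmain 0)
  rw [norm_smul, norm_coherentState, U.norm_map, norm_coherentState, mul_one] at h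
  exact h.symm

/-- A unitary that transforms coherent states by a unitary matrix is passive linear. -/
theorem isPassiveLinear_of_coherentState [DecidableEq κ] {U : Fock ι ≃ₗᵢ[ℂ] Fock κ} {u : Matrix κ ι ℂ}
    (hu1 : u * uᴴ = 1) (hu2 : uᴴ * u = 1)
    (hU : ∀ α, U (coherentState α) = coherentState (u *ᵥ α)) : IsPassiveLinear U := by
  let T : Fock ι →L[ℂ] Fock κ := U
  have hT : ∀ ψ, T ψ = U ψ := fun _ => rfl
  refine ⟨fun k l hkl => ?_, u, hu1, hu2, fun i k => funext fun l => ?_⟩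
  · have h1 : ∀ α : ι → ℂ, HasSum (fun k => T (numberState k) l / sqrtFactorial k
        * ∏ i, α i ^ k i) ((∏ i, (u *ᵥ α) i ^ l i) / sqrtFactorial l) := by
      intro α
      have h := (hasSum_map_numberState T α l).mul_left (vacuumAmplitude α)⁻¹
      have hv := vacuumAmplitude_ne_zero α
      rw [hT, hU, coherentState_apply, coherentCoeff_eq, vacuumAmplitude_mulVec hu2, mul_div_assoc,
        inv_mul_cancel_left₀ hv] at h
      refine (congrArg (fun f => HasSum f _) (funext fun k => ?_)).mpr h
      rw [coherentState_apply, coherentCoeff_eq]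
      field_simp
    -- The series in `h1` sums to a homogeneous polynomial of degree ∑ l i. Comparing its values at
    -- 2α and α shows that only terms with ∑ k i = ∑ l i survive.
    have h2 : (fun k => T (numberState k) l / sqrtFactorial k
        * ((2 : ℂ) ^ (∑ i, k i) - 2 ^ (∑ i, l i))) = 0 := by
      refine eq_zero_of_hasSum_monomial fun α => ?_
      have h3 := (h1 fun i => 2 * α i).sub ((h1 α).mul_left (2 ^ (∑ i, l i)))
      have h4 : (u *ᵥ fun i => 2 * α i) = (2 : ℂ) • (u *ᵥ α) := by
        rw [← Matrix.mulVec_smul]; rfl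
      rw [h4] at h3
      simp only [Pi.smul_apply, smul_eq_mul, mul_pow, Finset.prod_mul_distrib,
        Finset.prod_pow_eq_pow_sum, mul_div_assoc, sub_self] at h3
      refine (congrArg (fun f => HasSum f (0 : ℂ)) (funext fun k => ?_)).mpr h3
      ring
    have h5 := congrFun h2 k
    have h6 : (2 : ℂ) ^ (∑ i, k i) - 2 ^ (∑ i, l i) ≠ 0 := by
      rw [sub_ne_zero]
      intro h
      exact hkl (Nat.pow_right_injective le_rfl (by exact_mod_cast h))
    simpa [h6, sqrtFactorial_ne_zero, hT] using h5
  -- The generating series of the defect is the eigenvalue equation for U|α⟩ = |u α⟩, so it vanishes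
  -- for every α.
  · have h2 : (fun k => (annihilate i (U (numberState k)) l - U (∑ j, (u i j *
        ((Real.sqrt (k j : ℝ) : ℝ) : ℂ)) • numberState (k - Pi.single j 1)) l)
          / sqrtFactorial k) = 0 := by
      refine eq_zero_of_hasSum_monomial fun α => ?_
      have h3 := ((hasSum_annihilate_map T α i l).sub
        (hasSum_map_sum_annihilate T u α i l)).mul_left (vacuumAmplitude α)⁻¹
      have h4 : annihilate i (T (coherentState α)) l - (u *ᵥ α) i * T (coherentState α) l = 0 := by
        rw [hT, hU, annihilate_coherentState, Pi.smul_apply, smul_eq_mul, sub_self]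
      rw [h4, mul_zero] at h3
      refine (congrArg (fun f => HasSum f (0 : ℂ)) (funext fun k => ?_)).mpr h3
      have hv := vacuumAmplitude_ne_zero α
      simp only [hT]
      rw [coherentState_apply, coherentCoeff_eq]
      field_simp
    have h5 := congrFun h2 k
    simpa [sqrtFactorial_ne_zero, sub_eq_zero] using h5

/-- As b is orthogonal to the range of the isometry u, the shift adds ‖b‖² to every pairing of
amplitudes, and this cancels between the exponential and the two vacuum amplitudes. It is what makes
|y⟩ ↦ |W y + B β⟩ isometric without an extra phase. -/
theorem inner_coherentState_mulVec_add {u : Matrix κ ι ℂ} (hu : uᴴ * u = 1) {b : κ → ℂ}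
    (hb : uᴴ *ᵥ b = 0) (α β : ι → ℂ) :
    inner ℂ (coherentState (u *ᵥ α + b)) (coherentState (u *ᵥ β + b))
      = inner ℂ (coherentState α) (coherentState β) := by
  have h : ∀ α β : ι → ℂ, star (u *ᵥ α + b) ⬝ᵥ (u *ᵥ β + b) = star α ⬝ᵥ β + star b ⬝ᵥ b := by
    intro α β
    have h1 : star (u *ᵥ α) ⬝ᵥ (u *ᵥ β) = star α ⬝ᵥ β := by
      rw [Matrix.star_mulVec, ← Matrix.dotProduct_mulVec, Matrix.mulVec_mulVec, hu,
        Matrix.one_mulVec]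
    have h2 : ∀ α : ι → ℂ, star (u *ᵥ α) ⬝ᵥ b = 0 := by
      intro α
      rw [Matrix.star_mulVec, ← Matrix.dotProduct_mulVec, hb, dotProduct_zero]
    have h3 : star b ⬝ᵥ (u *ᵥ β) = 0 := by
      rw [← star_star (star b ⬝ᵥ (u *ᵥ β)), Matrix.star_dotProduct, star_star, h2, star_zero]
    rw [star_add, add_dotProduct, dotProduct_add, dotProduct_add, h1, h2, h3]
    ring
  rw [inner_coherentState, inner_coherentState, vacuumAmplitude, vacuumAmplitude, vacuumAmplitude,
    vacuumAmplitude, h, h, h, ← Complex.exp_add, ← Complex.exp_add, ← Complex.exp_add,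
    ← Complex.exp_add]
  congr 1
  ring

/-- Every unitary matrix is implemented by a passive linear unitary. -/
theorem exists_isPassiveLinear [DecidableEq κ] {u : Matrix κ ι ℂ} (hu1 : u * uᴴ = 1) (hu2 : uᴴ * u = 1) :
    ∃ U : Fock ι ≃ₗᵢ[ℂ] Fock κ, IsPassiveLinear U ∧
      ∀ α, U (coherentState α) = coherentState (u *ᵥ α) := by
  obtain ⟨L, hL⟩ := exists_isometry_coherentState (fun α => coherentState (u *ᵥ α))
    fun α β => by simpa using inner_coherentState_mulVec_add hu2 (Matrix.mulVec_zero _) α β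
  obtain ⟨L', hL'⟩ := exists_isometry_coherentState (fun α => coherentState (uᴴ *ᵥ α))
    fun α β => by
      simpa using inner_coherentState_mulVec_add (u := uᴴ)
        (by rwa [Matrix.conjTranspose_conjTranspose]) (Matrix.mulVec_zero _) α β
  have h1 : L.toContinuousLinearMap ∘L L'.toContinuousLinearMap = ContinuousLinearMap.id ℂ _ :=
    clm_ext_coherentState fun α => by simp [hL, hL', hu1]
  let U : Fock ι ≃ₗᵢ[ℂ] Fock κ := LinearIsometryEquiv.ofSurjective L fun ψ =>
    ⟨L' ψ, congrArg (fun T : Fock κ →L[ℂ] Fock κ => T ψ) h1⟩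
  have hU : ∀ α, U (coherentState α) = coherentState (u *ᵥ α) := hL
  exact ⟨U, isPassiveLinear_of_coherentState hu1 hu2 hU, hU⟩

end Passive

/-! ### Reduction of a unitary matrix -/

section Reduction

/-- An orthonormal basis of the column space of a matrix, as the columns of a matrix. -/
theorem exists_orthonormal_columns {m : ℕ} {J : Type*} [Fintype J] (A : Matrix (Fin m) J ℂ) :
    ∃ d ≤ Fintype.card J, ∃ (W : Matrix (Fin m) (Fin d) ℂ) (C : Matrix J (Fin d) ℂ),
      Wᴴ * W = 1 ∧ W * Wᴴ * A = A ∧ W = A * C := by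
  classical
  let v : J → EuclideanSpace ℂ (Fin m) := fun j => WithLp.toLp 2 fun i => A i j
  let K := Submodule.span ℂ (Set.range v)
  let b := stdOrthonormalBasis ℂ K
  refine ⟨Module.finrank ℂ K, finrank_range_le_card v, ?_⟩
  let W : Matrix (Fin m) (Fin (Module.finrank ℂ K)) ℂ :=
    Matrix.of fun i j => (b j : EuclideanSpace ℂ (Fin m)) i
  have hC : ∀ j, ∃ c : J → ℂ, ∑ l, c l • v l = (b j : EuclideanSpace ℂ (Fin m)) := fun j =>
    (Submodule.mem_span_range_iff_exists_fun ℂ).1 (b j).2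
  choose c hc using hC
  refine ⟨W, Matrix.of fun l j => c j l, ?_, ?_, ?_⟩
  · ext j k
    have h := (orthonormal_iff_ite.1 b.orthonormal) j k
    rw [Submodule.coe_inner, EuclideanSpace.inner_eq_star_dotProduct, dotProduct] at h
    rw [Matrix.mul_apply, Matrix.one_apply, ← h]
    refine Finset.sum_congr rfl fun i _ => ?_
    exact mul_comm _ _
  · ext i l
    have h1 := b.sum_repr' ⟨v l, Submodule.subset_span (Set.mem_range_self l)⟩
    have h2 := congrArg (fun x : K => (x : EuclideanSpace ℂ (Fin m)) i) h1
    have h3 : A i l = v l i := rfl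
    rw [h3, ← h2, Matrix.mul_assoc, Matrix.mul_apply]
    simp only [Submodule.coe_sum, Submodule.coe_smul, WithLp.ofLp_sum, WithLp.ofLp_smul,
      Finset.sum_apply, Pi.smul_apply, smul_eq_mul]
    refine Finset.sum_congr rfl fun j _ => ?_
    rw [Submodule.coe_inner, EuclideanSpace.inner_eq_star_dotProduct, dotProduct, mul_comm,
      Matrix.mul_apply]
    congr 1
    refine Finset.sum_congr rfl fun k _ => ?_
    exact mul_comm _ _
  · ext i j
    have h := congrArg (fun x : EuclideanSpace ℂ (Fin m) => x i) (hc j)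
    simp only [WithLp.ofLp_sum, WithLp.ofLp_smul, Finset.sum_apply, Pi.smul_apply,
      smul_eq_mul] at h
    rw [Matrix.mul_apply]
    simp only [W, Matrix.of_apply]
    rw [← h]
    exact Finset.sum_congr rfl fun l _ => mul_comm _ _

/-- A unitary matrix factors, up to a change of the basis of the input modes `Fin r` and of the
output modes `Fin q`, through a unitary matrix with at most `n'` of the input modes `Fin r`. -/
theorem exists_reduced_unitary {n n' r q : ℕ} {u : Matrix (Fin n' ⊕ Fin q) (Fin n ⊕ Fin r) ℂ}
    (hu1 : u * uᴴ = 1) (hu2 : uᴴ * u = 1) :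
    ∃ r' ≤ n', ∃ (q' : ℕ) (u' : Matrix (Fin n' ⊕ Fin q') (Fin n ⊕ Fin r') ℂ)
      (V : Matrix (Fin r') (Fin r) ℂ) (W : Matrix (Fin q) (Fin q') ℂ)
      (B : Matrix (Fin q) (Fin r) ℂ),
      u' * u'ᴴ = 1 ∧ u'ᴴ * u' = 1 ∧ Wᴴ * W = 1 ∧ Wᴴ * B = 0 ∧
      ∀ α β, ∃ x y, u' *ᵥ Sum.elim α (V *ᵥ β) = Sum.elim x y ∧
        u *ᵥ Sum.elim α β = Sum.elim x (W *ᵥ y + B *ᵥ β) := by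
  obtain ⟨P, Q, R, S, rfl⟩ : ∃ P Q R S, u = Matrix.fromBlocks P Q R S :=
    ⟨_, _, _, _, (Matrix.fromBlocks_toBlocks u).symm⟩
  rw [Matrix.fromBlocks_conjTranspose, Matrix.fromBlocks_multiply, ← Matrix.fromBlocks_one,
    Matrix.fromBlocks_inj] at hu1 hu2
  obtain ⟨hPP, hPR, -, hRR⟩ := hu1
  obtain ⟨kPP, kPQ, kQP, kQQ⟩ := hu2
  -- The bound r' ≤ n' arises here: `Qᴴ` has n' columns. They span the orthogonal complement of ker
  -- Q, the part of the ancilla seen by the kept modes.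
  obtain ⟨r', hr', V, -, hVV, hVQ, -⟩ := exists_orthonormal_columns Qᴴ
  rw [Fintype.card_fin] at hr'
  have hQV : Q * V * Vᴴ = Q := by
    have := congrArg Matrix.conjTranspose hVQ
    simpa [Matrix.conjTranspose_mul, Matrix.mul_assoc] using this
  -- The orthogonal projection onto ker Q.
  let N : Matrix (Fin r) (Fin r) ℂ := 1 - V * Vᴴ
  have hNdef : V * Vᴴ = 1 - N := by simp [N]
  have hNH : Nᴴ = N := by simp [N, Matrix.conjTranspose_mul]
  have hQN : Q * N = 0 := by rw [Matrix.mul_sub, ← Matrix.mul_assoc, hQV, Matrix.mul_one, sub_self]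
  have hNQ : N * Qᴴ = 0 := by
    rw [← hNH, ← Matrix.conjTranspose_mul, hQN, Matrix.conjTranspose_zero]
  have hNV : N * V = 0 := by
    rw [Matrix.sub_mul, Matrix.mul_assoc, hVV, Matrix.mul_one, Matrix.one_mul, sub_self]
  have hNN : N * N = N := by
    change N * (1 - V * Vᴴ) = N
    rw [Matrix.mul_sub, ← Matrix.mul_assoc, hNV, Matrix.zero_mul, Matrix.mul_one, sub_zero]
  have hSS : Sᴴ * S = 1 - Qᴴ * Q := eq_sub_of_add_eq' kQQ
  have hSR : Sᴴ * R = -(Qᴴ * P) := eq_neg_of_add_eq_zero_right kQP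
  have hNSS : N * (Sᴴ * S) = N := by
    rw [hSS, Matrix.mul_sub, ← Matrix.mul_assoc, hNQ, Matrix.zero_mul, Matrix.mul_one, sub_zero]
  -- By `hNSS`, S is isometric on ker Q, so G is the orthogonal projection onto S(ker Q). The ranges
  -- of R and S V are orthogonal to it (`hGR`, `hGSV`).
  let G : Matrix (Fin q) (Fin q) ℂ := S * N * Sᴴ
  have hGH : Gᴴ = G := by simp [G, Matrix.conjTranspose_mul, hNH, Matrix.mul_assoc]
  have hGS : G * S = S * N := by
    rw [Matrix.mul_assoc, Matrix.mul_assoc, hNSS]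
  have hGG : G * G = G := by
    change G * (S * N * Sᴴ) = G
    rw [← Matrix.mul_assoc, ← Matrix.mul_assoc, hGS, Matrix.mul_assoc S, hNN]
  have hGR : G * R = 0 := by
    rw [Matrix.mul_assoc, hSR, Matrix.mul_neg, Matrix.mul_assoc, ← Matrix.mul_assoc N, hNQ,
      Matrix.zero_mul, Matrix.mul_zero, neg_zero]
  have hRG : Rᴴ * G = 0 := by
    rw [← hGH, ← Matrix.conjTranspose_mul, hGR, Matrix.conjTranspose_zero]
  have hGSV : G * (S * V) = 0 := by
    rw [← Matrix.mul_assoc, hGS, Matrix.mul_assoc, hNV, Matrix.mul_zero]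
  -- The columns of W are an orthonormal basis of the complement of S(ker Q) in the discarded modes.
  -- The value of q' plays no role.
  obtain ⟨q', -, W, C, hWW, hWG, hWC⟩ := exists_orthonormal_columns (1 - G)
  have hWG0 : Wᴴ * G = 0 := by
    rw [hWC, Matrix.conjTranspose_mul, Matrix.conjTranspose_sub, hGH, Matrix.conjTranspose_one,
      Matrix.mul_assoc, Matrix.sub_mul, hGG, Matrix.one_mul, sub_self, Matrix.mul_zero]
  have hWW' : W * Wᴴ = 1 - G := by
    rw [← hWG, Matrix.mul_sub, Matrix.mul_assoc W Wᴴ G, hWG0, Matrix.mul_zero, Matrix.mul_one,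
      sub_zero]
  have hWB : Wᴴ * (S * N) = 0 := by rw [← hGS, ← Matrix.mul_assoc, hWG0, Matrix.zero_mul]
  have hWWR : W * (Wᴴ * R) = R := by
    rw [← Matrix.mul_assoc, hWW', Matrix.sub_mul, hGR, Matrix.one_mul, sub_zero]
  have hWWSV : W * (Wᴴ * (S * V)) = S * V := by
    rw [← Matrix.mul_assoc, hWW', Matrix.sub_mul, hGSV, Matrix.one_mul, sub_zero]
  refine ⟨r', hr', q', Matrix.fromBlocks P (Q * V) (Wᴴ * R) (Wᴴ * (S * V)), Vᴴ, W, S * N,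
    ?_, ?_, hWW, hWB, fun α β => ?_⟩
  · have e1 : Q * V * (Q * V)ᴴ = Q * Qᴴ := by
      rw [Matrix.conjTranspose_mul, ← Matrix.mul_assoc, hQV]
    have e2 : (P * (Wᴴ * R)ᴴ + Q * V * (Wᴴ * (S * V))ᴴ) = 0 := by
      calc _ = (P * Rᴴ + Q * V * Vᴴ * Sᴴ) * W := by
            simp only [Matrix.conjTranspose_mul, Matrix.conjTranspose_conjTranspose,
              Matrix.add_mul, Matrix.mul_assoc]
        _ = 0 := by rw [hQV, hPR, Matrix.zero_mul]
    have e3 : Wᴴ * R * Pᴴ + Wᴴ * (S * V) * (Q * V)ᴴ = 0 := by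
      have := congrArg Matrix.conjTranspose e2
      simpa [Matrix.conjTranspose_add, Matrix.conjTranspose_mul, Matrix.mul_assoc] using this
    have e4 : Wᴴ * R * (Wᴴ * R)ᴴ + Wᴴ * (S * V) * (Wᴴ * (S * V))ᴴ = 1 := by
      calc _ = Wᴴ * (R * Rᴴ + S * (V * Vᴴ) * Sᴴ) * W := by
            simp only [Matrix.conjTranspose_mul, Matrix.conjTranspose_conjTranspose,
              Matrix.add_mul, Matrix.mul_add, Matrix.mul_assoc]
        _ = Wᴴ * (1 - G) * W := by
            rw [hNdef, Matrix.mul_sub, Matrix.sub_mul, Matrix.mul_one, ← add_sub_assoc, hRR]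
        _ = 1 := by rw [Matrix.mul_sub, hWG0, Matrix.mul_one, sub_zero, hWW]
    rw [Matrix.fromBlocks_conjTranspose, Matrix.fromBlocks_multiply, e1, e2, e3, e4, hPP,
      Matrix.fromBlocks_one]
  · have e1 : Pᴴ * P + (Wᴴ * R)ᴴ * (Wᴴ * R) = 1 := by
      rw [Matrix.conjTranspose_mul, Matrix.conjTranspose_conjTranspose, Matrix.mul_assoc, hWWR, kPP]
    have e2 : Pᴴ * (Q * V) + (Wᴴ * R)ᴴ * (Wᴴ * (S * V)) = 0 := by
      rw [Matrix.conjTranspose_mul, Matrix.conjTranspose_conjTranspose, Matrix.mul_assoc, hWWSV,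
        ← Matrix.mul_assoc, ← Matrix.mul_assoc, ← Matrix.add_mul, kPQ, Matrix.zero_mul]
    have e3 : (Q * V)ᴴ * P + (Wᴴ * (S * V))ᴴ * (Wᴴ * R) = 0 := by
      have := congrArg Matrix.conjTranspose e2
      simpa [Matrix.conjTranspose_add, Matrix.conjTranspose_mul, Matrix.mul_assoc] using this
    have e4 : (Q * V)ᴴ * (Q * V) + (Wᴴ * (S * V))ᴴ * (Wᴴ * (S * V)) = 1 := by
      rw [Matrix.conjTranspose_mul Wᴴ, Matrix.conjTranspose_conjTranspose, Matrix.mul_assoc _ W,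
        hWWSV]
      calc _ = Vᴴ * (Qᴴ * Q + Sᴴ * S) * V := by
            simp only [Matrix.conjTranspose_mul, Matrix.add_mul, Matrix.mul_add, Matrix.mul_assoc]
        _ = 1 := by rw [kQQ, Matrix.mul_one, hVV]
    rw [Matrix.fromBlocks_conjTranspose, Matrix.fromBlocks_multiply, e1, e2, e3, e4,
      Matrix.fromBlocks_one]
  -- Split β = V Vᴴ β + N β. The second part is invisible to Q and adds S N β to the discarded
  -- amplitudes.
  · refine ⟨_, _, Matrix.fromBlocks_mulVec _ _ _ _ _, ?_⟩
    rw [Matrix.fromBlocks_mulVec]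
    simp only [Sum.elim_comp_inl, Sum.elim_comp_inr]
    congr 1
    · rw [Matrix.mulVec_mulVec, hQV]
    · rw [Matrix.mulVec_add, Matrix.mulVec_mulVec, Matrix.mulVec_mulVec, hWWR, Matrix.mulVec_mulVec,
        hWWSV, add_assoc, ← Matrix.add_mulVec, Matrix.mul_assoc, ← Matrix.mul_add, hNdef,
        sub_add_cancel, Matrix.mul_one]

end Reduction

/-! ### Trace class operators and partial traces -/

section TraceClass

open InnerProductSpace (rankOne)
open ContinuousLinearMap (adjoint)

variable {ι κ κ' ν : Type*}

theorem exists_selfAdjoint_sqrt {H : Type*} [NormedAddCommGroup H] [InnerProductSpace ℂ H]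
    [CompleteSpace H] {T : H →L[ℂ] H} (hT : T.IsPositive) :
    ∃ A : H →L[ℂ] H, adjoint A = A ∧ A ∘L A = T := by
  have h0 : 0 ≤ T := (ContinuousLinearMap.nonneg_iff_isPositive T).2 hT
  refine ⟨CFC.sqrt T, ?_, CFC.sqrt_mul_sqrt_self T h0⟩
  exact ((ContinuousLinearMap.nonneg_iff_isPositive _).1 (CFC.sqrt_nonneg T)).isSelfAdjoint.adjoint_eq

/-- A positive operator of finite trace is a sum of rank one operators. -/
theorem exists_decomposition {ρ : Fock ν →L[ℂ] Fock ν} (hρ : ρ.IsPositive)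
    (htr : Summable fun k => entry ρ k k) :
    ∃ x : (ν → ℕ) → Fock ν, (Summable fun k => ‖x k‖ ^ 2) ∧
      ∀ φ ψ, HasSum (fun k => inner ℂ φ (x k) * inner ℂ (x k) ψ) (inner ℂ φ (ρ ψ)) := by
  obtain ⟨A, hA, hAA⟩ := exists_selfAdjoint_sqrt hρ
  have hin : ∀ φ ψ, inner ℂ φ (A ψ) = inner ℂ (A φ) ψ := fun φ ψ => by
    rw [← ContinuousLinearMap.adjoint_inner_left, hA]
  -- With A = √ρ, inserting the number basis in the middle of A A gives ρ = ∑ A|k⟩⟨k|A, and ∑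
  -- ‖A|k⟩‖² is the trace.
  refine ⟨fun k => A (numberState k), ?_, fun φ ψ => ?_⟩
  · have h : ∀ k, entry ρ k k = ((‖A (numberState k)‖ ^ 2 : ℝ) : ℂ) := by
      intro k
      rw [entry_eq_inner, ← hAA, ContinuousLinearMap.comp_apply, hin,
        inner_self_eq_norm_sq_to_K]
      push_cast
      rfl
    simp only [h] at htr
    exact Complex.summable_ofReal.1 htr
  · have h : HasSum (fun k => inner ℂ (A φ k) (A ψ k)) (inner ℂ (A φ) (A ψ)) :=
      lp.hasSum_inner (A φ) (A ψ)
    refine h.of_eq (fun k => ?_) ?_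
    · rw [hin, ← hin (numberState k), inner_numberState_right, inner_numberState_left,
        RCLike.inner_apply, mul_comm]
      rfl
    · rw [← hAA, ContinuousLinearMap.comp_apply, hin]

theorem summable_sq_apply {J : Type*} {x : J → Fock ι} (hx : Summable fun j => ‖x j‖ ^ 2) :
    Summable fun p : J × (ι → ℕ) => ‖x p.1 p.2‖ ^ 2 := by
  refine (summable_prod_of_nonneg fun _ => by positivity).2 ⟨fun j => summable_sq (x j), ?_⟩
  simpa only [norm_sq_eq] using hx

/-- Square summable families of vectors define trace class operators. -/
theorem exists_traceClass {J : Type*} {x : J → Fock ι} (hx : Summable fun j => ‖x j‖ ^ 2) :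
    ∃ R ∈ traceClass ι, ‖R‖ ≤ ∑' j, ‖x j‖ ^ 2 ∧
      ∀ s t, HasSum (fun j => x j s * star (x j t)) (entry R s t) := by
  have hn : ∀ j, ‖rankOne ℂ (x j) (x j)‖ = ‖x j‖ ^ 2 := fun j => by
    rw [InnerProductSpace.norm_rankOne, sq]
  have hs : Summable fun j => rankOne ℂ (x j) (x j) :=
    Summable.of_norm (by simpa only [hn] using hx)
  let R := ∑' j, rankOne ℂ (x j) (x j)
  have happ : ∀ φ ψ, HasSum (fun j => inner ℂ φ (x j) * inner ℂ (x j) ψ) (inner ℂ φ (R ψ)) := by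
    intro φ ψ
    have h := (hs.hasSum.mapL (ContinuousLinearMap.apply ℂ (Fock ι) ψ)).mapL (innerSL ℂ φ)
    refine h.of_eq (fun j => ?_) rfl
    simp [mul_comm]
  have hent : ∀ s t, HasSum (fun j => x j s * star (x j t)) (entry R s t) := fun s t => by
    have h := happ (numberState s) (numberState t)
    simp only [inner_numberState_left, inner_numberState_right] at h
    exact h
  refine ⟨R, Submodule.subset_span ⟨?_, ?_⟩, ?_, hent⟩
  · rw [ContinuousLinearMap.isPositive_iff_complex]
    intro ψ
    have h : HasSum (fun j => ((‖inner ℂ (x j) ψ‖ ^ 2 : ℝ) : ℂ)) (inner ℂ (R ψ) ψ) := by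
      have h1 := (happ ψ ψ).star
      refine h1.of_eq (fun j => ?_) (inner_conj_symm _ _).symm
      rw [← inner_conj_symm ψ (x j), Complex.conj_mul', star_pow, RCLike.star_def,
        Complex.conj_ofReal]
      push_cast
      rfl
    have hsum := Complex.summable_ofReal.1 h.summable
    rw [← h.tsum_eq, ← Complex.ofReal_tsum]
    exact ⟨rfl, tsum_nonneg fun _ => by positivity⟩
  · have h1 := (summable_sq_apply hx).prod_symm
    have h2 := h1.prod
    have h3 : ∀ k, entry R k k = ((∑' j, ‖x j k‖ ^ 2 : ℝ) : ℂ) := by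
      intro k
      rw [← (hent k k).tsum_eq, Complex.ofReal_tsum]
      refine tsum_congr fun j => ?_
      rw [RCLike.star_def, Complex.mul_conj']
      push_cast
      rfl
    simp only [h3]
    exact Complex.summable_ofReal.2 h2
  · have hx' : Summable fun j => ‖rankOne ℂ (x j) (x j)‖ := by simpa only [hn] using hx
    refine (norm_tsum_le_tsum_norm hx').trans ?_
    simp only [hn, le_refl]

/-- Fubini for a dominated double series. The bound on finite sums is recorded because its
uniformity is needed later, when the ancilla amplitude is integrated. -/
theorem hasSum_exchange {J A : Type*} {f : J × A → ℂ} {g : J × A → ℝ} (hg : Summable g)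
    (hfg : ∀ p, ‖f p‖ ≤ g p) {e : A → ℂ} (he : ∀ a, HasSum (fun j => f (j, a)) (e a)) {v : J → ℂ}
    (hv : ∀ j, HasSum (fun a => f (j, a)) (v j)) :
    HasSum e (∑' j, v j) ∧ (∀ F : Finset A, ∑ a ∈ F, ‖e a‖ ≤ ∑' p, g p) ∧
      HasSum f (∑' j, v j) := by
  have hf : Summable f := Summable.of_norm_bounded hg hfg
  have h1 : HasSum v (∑' p, f p) := hf.hasSum.prod_fiberwise hv
  have hsw : HasSum (f ∘ Prod.swap) (∑' p, f p) := (Equiv.prodComm A J).hasSum_iff.2 hf.hasSum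
  have h2 : HasSum e (∑' p, f p) := hsw.prod_fiberwise he
  rw [h1.tsum_eq]
  refine ⟨h2, fun F => ?_, hf.hasSum⟩
  have hgs := hg.prod_symm
  have hg0 : ∀ p, 0 ≤ g p := fun p => (norm_nonneg _).trans (hfg p)
  have hbound : ∀ a, ‖e a‖ ≤ ∑' j, g (j, a) := by
    intro a
    rw [← (he a).tsum_eq]
    exact tsum_of_norm_bounded (hgs.prod_factor a).hasSum fun j => hfg (j, a)
  refine (Finset.sum_le_sum fun a _ => hbound a).trans ?_
  refine (hgs.prod.sum_le_tsum F fun a _ => tsum_nonneg fun j => hg0 _).trans ?_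
  rw [← (Equiv.prodComm A J).tsum_eq g]
  exact hgs.tsum_prod.symm.le

/-- The partial trace of an operator given as a sum of rank one operators. -/
theorem hasSum_entry_diagonal {J : Type*} {X Z : J → Fock (ι ⊕ κ)}
    (hX : Summable fun j => ‖X j‖ ^ 2) (hZ : Summable fun j => ‖Z j‖ ^ 2)
    {T : Fock (ι ⊕ κ) →L[ℂ] Fock (ι ⊕ κ)}
    (hT : ∀ z w, HasSum (fun j => Z j z * star (X j w)) (entry T z w)) (s t : ι → ℕ) :
    HasSum (fun a : κ → ℕ => entry T (Sum.elim s a) (Sum.elim t a))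
        (∑' j, inner ℂ (row t (X j)) (row s (Z j))) ∧
      (∀ F : Finset (κ → ℕ), ∑ a ∈ F, ‖entry T (Sum.elim s a) (Sum.elim t a)‖
        ≤ ∑' j, ‖Z j‖ ^ 2 + ∑' j, ‖X j‖ ^ 2) ∧
      HasSum (fun p : J × (κ → ℕ) => Z p.1 (Sum.elim s p.2) * star (X p.1 (Sum.elim t p.2)))
        (∑' j, inner ℂ (row t (X j)) (row s (Z j))) := by
  have hrow : ∀ (Y : J → Fock (ι ⊕ κ)) (r : ι → ℕ), (Summable fun j => ‖Y j‖ ^ 2) →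
      Summable fun j => ‖row r (Y j)‖ ^ 2 := fun Y r h =>
    Summable.of_nonneg_of_le (fun _ => by positivity)
      (fun j => pow_le_pow_left₀ (norm_nonneg _) (norm_row_le r (Y j)) 2) h
  have hsZ := summable_sq_apply (hrow Z s hZ)
  have hsX := summable_sq_apply (hrow X t hX)
  have hle : ∀ a b : ℂ, ‖a * star b‖ ≤ ‖a‖ ^ 2 + ‖b‖ ^ 2 := fun a b => by
    rw [norm_mul, norm_star]
    nlinarith [sq_nonneg (‖a‖ - ‖b‖), sq_nonneg ‖a‖, sq_nonneg ‖b‖]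
  have hv : ∀ j, HasSum (fun a => row s (Z j) a * star (row t (X j) a))
      (inner ℂ (row t (X j)) (row s (Z j))) := fun j => lp.hasSum_inner (row t (X j)) (row s (Z j))
  obtain ⟨h1, h2, h3⟩ := hasSum_exchange
    (f := fun p : J × (κ → ℕ) => row s (Z p.1) p.2 * star (row t (X p.1) p.2))
    (hsZ.add hsX) (fun p => hle _ _) (fun a => hT (Sum.elim s a) (Sum.elim t a)) hv
  refine ⟨h1, fun F => (h2 F).trans ?_, h3⟩
  rw [hsZ.tsum_add hsX, hsZ.tsum_prod, hsX.tsum_prod]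
  simp only [← norm_sq_eq]
  exact add_le_add
    ((hrow Z s hZ).tsum_le_tsum (fun j => pow_le_pow_left₀ (norm_nonneg _) (norm_row_le s (Z j)) 2)
      hZ)
    ((hrow X t hX).tsum_le_tsum (fun j => pow_le_pow_left₀ (norm_nonneg _) (norm_row_le t (X j)) 2)
      hX)

theorem hasSum_entry_sandwich {J : Type*} {x : J → Fock ν} {ρ : Fock ν →L[ℂ] Fock ν}
    (hρ : ∀ φ ψ, HasSum (fun j => inner ℂ φ (x j) * inner ℂ (x j) ψ) (inner ℂ φ (ρ ψ)))
    (A B : Fock ν →L[ℂ] Fock ι) (z w : ι → ℕ) :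
    HasSum (fun j => A (x j) z * star (B (x j) w)) (entry (A ∘L ρ ∘L adjoint B) z w) := by
  refine (hρ (adjoint A (numberState z)) (adjoint B (numberState w))).of_eq (fun j => ?_) ?_
  · rw [ContinuousLinearMap.adjoint_inner_left, ContinuousLinearMap.adjoint_inner_right,
      inner_numberState_left, inner_numberState_right]
  · rw [ContinuousLinearMap.adjoint_inner_left, inner_numberState_left]
    rfl

theorem summable_sq_map {J H H' : Type*} [NormedAddCommGroup H] [NormedSpace ℂ H]
    [NormedAddCommGroup H'] [NormedSpace ℂ H'] {x : J → H} (hx : Summable fun j => ‖x j‖ ^ 2)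
    (A : H →L[ℂ] H') {c : ℝ} (hA : ‖A‖ ≤ c) :
    (Summable fun j => ‖A (x j)‖ ^ 2) ∧ ∑' j, ‖A (x j)‖ ^ 2 ≤ c ^ 2 * ∑' j, ‖x j‖ ^ 2 := by
  have hle : ∀ j, ‖A (x j)‖ ^ 2 ≤ c ^ 2 * ‖x j‖ ^ 2 := fun j => by
    rw [← mul_pow]
    exact pow_le_pow_left₀ (norm_nonneg _) (A.le_of_opNorm_le hA (x j)) 2
  have hs := Summable.of_nonneg_of_le (fun _ => by positivity) hle (hx.mul_left (c ^ 2))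
  refine ⟨hs, ?_⟩
  rw [← tsum_mul_left]
  exact hs.tsum_le_tsum hle (hx.mul_left (c ^ 2))

/-- The vectors ⟨a|Y_j⟩ decompose the partial trace of ∑ |Y_j⟩⟨Y_j| into rank one operators, with
the same total trace. -/
theorem summable_sq_col {J : Type*} {Y : J → Fock (ι ⊕ κ)} (hY : Summable fun j => ‖Y j‖ ^ 2) :
    (Summable fun p : J × (κ → ℕ) => ‖col p.2 (Y p.1)‖ ^ 2) ∧
      ∑' p : J × (κ → ℕ), ‖col p.2 (Y p.1)‖ ^ 2 = ∑' j, ‖Y j‖ ^ 2 := by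
  have hs : Summable fun p : J × (κ → ℕ) => ‖col p.2 (Y p.1)‖ ^ 2 := by
    refine (summable_prod_of_nonneg fun _ => by positivity).2
      ⟨fun j => (hasSum_norm_col (Y j)).summable, ?_⟩
    simpa only [(hasSum_norm_col (Y _)).tsum_eq] using hY
  refine ⟨hs, ?_⟩
  rw [hs.tsum_prod]
  exact tsum_congr fun j => (hasSum_norm_col (Y j)).tsum_eq

/-- The operators `(1 ⊗ E) K ρ K†` have trace class partial traces, with bounds uniform in the
contraction `K`. -/
theorem exists_partialTrace {E : Fock κ →L[ℂ] Fock κ} (hE : E.IsPositive)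
    {ρ : Fock ν →L[ℂ] Fock ν} (hρ : ρ ∈ traceClass ν) :
    ∃ C : ℝ, ∀ K : Fock ν →L[ℂ] Fock (ι ⊕ κ), ‖K‖ ≤ 1 → ∃ R ∈ traceClass ι, ‖R‖ ≤ C ∧
      IsPartialTrace (onRight ι E ∘L K ∘L ρ ∘L adjoint K) R ∧
      ∀ (s t : ι → ℕ) (F : Finset (κ → ℕ)), ∑ a ∈ F,
        ‖entry (onRight ι E ∘L K ∘L ρ ∘L adjoint K) (Sum.elim s a) (Sum.elim t a)‖ ≤ C := by
  induction hρ using Submodule.span_induction with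
  | mem ρ hρ =>
    obtain ⟨x, hx, hxρ⟩ := exists_decomposition hρ.1 hρ.2
    -- With A = √E, the partial trace of (1 ⊗ E) T equals that of (1 ⊗ A) T (1 ⊗ A), which is
    -- visibly positive when T is.
    obtain ⟨A, hA, hAA⟩ := exists_selfAdjoint_sqrt hE
    have hAin : ∀ φ ψ : Fock κ, inner ℂ (A φ) (A ψ) = inner ℂ φ (E ψ) := fun φ ψ => by
      rw [← hAA, ContinuousLinearMap.comp_apply, ← ContinuousLinearMap.adjoint_inner_right, hA]
    let S := ∑' k, ‖x k‖ ^ 2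
    have hS : 0 ≤ S := tsum_nonneg fun _ => by positivity
    -- The first term bounds ‖R‖, the other two bound the diagonal sums; none involves K.
    refine ⟨‖onRight ι A‖ ^ 2 * S + (‖onRight ι E‖ ^ 2 * S + 1 ^ 2 * S), fun K hK => ?_⟩
    obtain ⟨hX, hXle⟩ := summable_sq_map hx K hK
    have hnorm : ∀ D : Fock κ →L[ℂ] Fock κ, ‖onRight ι D ∘L K‖ ≤ ‖onRight ι D‖ := fun D =>
      (ContinuousLinearMap.opNorm_comp_le _ _).trans
        (mul_le_of_le_one_right (norm_nonneg _) hK)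
    obtain ⟨hZ, hZle⟩ := summable_sq_map hx (onRight ι E ∘L K) (hnorm E)
    obtain ⟨hY, hYle⟩ := summable_sq_map hx (onRight ι A ∘L K) (hnorm A)
    obtain ⟨hcol, hcoleq⟩ := summable_sq_col hY
    obtain ⟨R, hR, hRn, hRe⟩ := exists_traceClass
      (x := fun p : (ν → ℕ) × (κ → ℕ) => col p.2 ((onRight ι A ∘L K) (x p.1))) hcol
    have hdiag := hasSum_entry_diagonal hX hZ (hasSum_entry_sandwich hxρ (onRight ι E ∘L K) K)
    refine ⟨R, hR, ?_, fun s t => ?_, fun s t F => ?_⟩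
    · rw [hcoleq] at hRn
      have : 0 ≤ ‖onRight ι E‖ ^ 2 * S + 1 ^ 2 * S := by positivity
      linarith
    · have h1 := (hasSum_entry_diagonal hY hY
        (hasSum_entry_sandwich hxρ (onRight ι A ∘L K) (onRight ι A ∘L K)) s t).2.2
      have h2 := (hdiag s t).1
      have h3 : entry R s t = ∑' k, inner ℂ (row t (K (x k))) (row s ((onRight ι E ∘L K) (x k))) := by
        refine (hRe s t).unique (h1.of_eq (fun _ => rfl) (tsum_congr fun k => ?_))
        rw [ContinuousLinearMap.comp_apply, ContinuousLinearMap.comp_apply, row_onRight,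
          row_onRight, row_onRight, hAin]
      rw [h3]
      exact h2
    · refine ((hdiag s t).2.1 F).trans ?_
      have : 0 ≤ ‖onRight ι A‖ ^ 2 * S := by positivity
      linarith
  | zero =>
    refine ⟨0, fun K _ => ⟨0, Submodule.zero_mem _, by simp, fun s t => ?_, fun s t F => ?_⟩⟩
    · simp [entry]
    · simp [entry]
  | add ρ₁ ρ₂ _ _ h₁ h₂ =>
    obtain ⟨C₁, h₁⟩ := h₁
    obtain ⟨C₂, h₂⟩ := h₂
    refine ⟨C₁ + C₂, fun K hK => ?_⟩
    obtain ⟨R₁, hR₁, hn₁, hp₁, hb₁⟩ := h₁ K hK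
    obtain ⟨R₂, hR₂, hn₂, hp₂, hb₂⟩ := h₂ K hK
    have he : onRight ι E ∘L K ∘L (ρ₁ + ρ₂) ∘L adjoint K
        = onRight ι E ∘L K ∘L ρ₁ ∘L adjoint K + onRight ι E ∘L K ∘L ρ₂ ∘L adjoint K := by
      simp only [ContinuousLinearMap.add_comp, ContinuousLinearMap.comp_add]
    rw [he]
    refine ⟨R₁ + R₂, Submodule.add_mem _ hR₁ hR₂, (norm_add_le _ _).trans (add_le_add hn₁ hn₂),
      fun s t => ?_, fun s t F => ?_⟩
    · exact (hp₁ s t).add (hp₂ s t)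
    · refine le_trans ?_ (add_le_add (hb₁ s t F) (hb₂ s t F))
      rw [← Finset.sum_add_distrib]
      exact Finset.sum_le_sum fun a _ => norm_add_le _ _
  | smul c ρ _ h =>
    obtain ⟨C, h⟩ := h
    refine ⟨‖c‖ * C, fun K hK => ?_⟩
    obtain ⟨R, hR, hn, hp, hb⟩ := h K hK
    have he : onRight ι E ∘L K ∘L (c • ρ) ∘L adjoint K
        = c • (onRight ι E ∘L K ∘L ρ ∘L adjoint K) := by
      simp only [ContinuousLinearMap.smul_comp, ContinuousLinearMap.comp_smul]
    rw [he]
    refine ⟨c • R, Submodule.smul_mem _ _ hR, ?_, fun s t => ?_, fun s t F => ?_⟩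
    · rw [norm_smul]
      exact mul_le_mul_of_nonneg_left hn (norm_nonneg _)
    · exact (hp s t).mul_left c
    · simp only [entry_smul, norm_mul, ← Finset.mul_sum]
      exact mul_le_mul_of_nonneg_left (hb s t F) (norm_nonneg _)

/-- An isometry on the discarded modes can be moved from the state to the measurement. -/
theorem exists_hasSum_entry_transfer (E : Fock κ →L[ℂ] Fock κ) {ρ : Fock ν →L[ℂ] Fock ν}
    (hρ : ρ ∈ traceClass ν) {K : Fock ν →L[ℂ] Fock (ι ⊕ κ)} {K' : Fock ν →L[ℂ] Fock (ι ⊕ κ')}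
    {L : Fock κ' →L[ℂ] Fock κ} {c : ℂ} (hc : ‖c‖ = 1)
    (hK : ∀ s x, row s (K x) = c • L (row s (K' x))) (s t : ι → ℕ) :
    ∃ v, HasSum (fun a : κ → ℕ => entry (onRight ι E ∘L K ∘L ρ ∘L adjoint K)
        (Sum.elim s a) (Sum.elim t a)) v ∧
      HasSum (fun a : κ' → ℕ => entry (onRight ι (adjoint L ∘L E ∘L L) ∘L K' ∘L ρ ∘L adjoint K')
        (Sum.elim s a) (Sum.elim t a)) v := by
  induction hρ using Submodule.span_induction with
  | mem ρ hρ =>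
    obtain ⟨x, hx, hxρ⟩ := exists_decomposition hρ.1 hρ.2
    have hX := (summable_sq_map hx K le_rfl).1
    have hX' := (summable_sq_map hx K' le_rfl).1
    have hZ := (summable_sq_map hx (onRight ι E ∘L K) le_rfl).1
    have hZ' := (summable_sq_map hx (onRight ι (adjoint L ∘L E ∘L L) ∘L K') le_rfl).1
    refine ⟨_, (hasSum_entry_diagonal hX hZ (hasSum_entry_sandwich hxρ _ K) s t).1, ?_⟩
    refine (hasSum_entry_diagonal hX' hZ' (hasSum_entry_sandwich hxρ _ K') s t).1.of_eq
      (fun _ => rfl) (tsum_congr fun k => ?_)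
    -- Both traces are sums of matrix elements of the measurement between rows; `hK` inserts L on
    -- both sides, and the phase cancels as ‖c‖² = 1.
    rw [ContinuousLinearMap.comp_apply, ContinuousLinearMap.comp_apply, row_onRight, row_onRight,
      hK, hK, map_smul, inner_smul_left, inner_smul_right, ← mul_assoc, Complex.conj_mul', hc,
      ContinuousLinearMap.comp_apply, ContinuousLinearMap.comp_apply,
      ContinuousLinearMap.adjoint_inner_right]
    simp
  | zero =>
    refine ⟨0, ?_, ?_⟩
    · simp [entry]
    · simp [entry]
  | add ρ₁ ρ₂ _ _ h₁ h₂ =>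
    obtain ⟨v₁, h₁, h₁'⟩ := h₁
    obtain ⟨v₂, h₂, h₂'⟩ := h₂
    simp only [ContinuousLinearMap.add_comp, ContinuousLinearMap.comp_add, entry_add]
    exact ⟨v₁ + v₂, h₁.add h₂, h₁'.add h₂'⟩
  | smul c ρ _ h =>
    obtain ⟨v, h, h'⟩ := h
    simp only [ContinuousLinearMap.smul_comp, ContinuousLinearMap.comp_smul, entry_smul]
    exact ⟨c * v, h.mul_left c, h'.mul_left c⟩

end TraceClass

/-! ### Adding an ancilla in a pure state -/

section Ancilla

open InnerProductSpace (rankOne)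
open ContinuousLinearMap (adjoint)

variable {ι κ ν : Type*}

theorem summable_sq_mul (x : Fock ι) (φ : Fock κ) :
    Summable fun p : (ι → ℕ) × (κ → ℕ) => ‖x p.1 * φ p.2‖ ^ 2 := by
  simpa only [norm_mul, mul_pow] using (summable_sq x).mul_of_nonneg (summable_sq φ)
    (fun _ => by positivity) (fun _ => by positivity)

/-- The vector `x ⊗ φ`. -/
def tensorVecAux (φ : Fock κ) (x : Fock ι) : Fock (ι ⊕ κ) :=
  ⟨fun z => x ((splitLeft ι κ).symm z).1 * φ ((splitLeft ι κ).symm z).2,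
    memlp_two (((splitLeft ι κ).symm.summable_iff
      (f := fun p : (ι → ℕ) × (κ → ℕ) => ‖x p.1 * φ p.2‖ ^ 2)).2 (summable_sq_mul x φ))⟩

theorem norm_tensorVecAux (φ : Fock κ) (x : Fock ι) : ‖tensorVecAux φ x‖ = ‖φ‖ * ‖x‖ := by
  have h : ‖tensorVecAux φ x‖ ^ 2 = (‖φ‖ * ‖x‖) ^ 2 := by
    have h1 : ‖tensorVecAux φ x‖ ^ 2 = ∑' p : (ι → ℕ) × (κ → ℕ), ‖x p.1 * φ p.2‖ ^ 2 := by
      rw [norm_sq_eq]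
      exact (splitLeft ι κ).symm.tsum_eq
        (fun p : (ι → ℕ) × (κ → ℕ) => ‖x p.1 * φ p.2‖ ^ 2)
    rw [h1, mul_pow, mul_comm, norm_sq_eq, norm_sq_eq, (summable_sq x).tsum_mul_tsum (summable_sq φ)]
    · simp only [norm_mul, mul_pow]
    · simpa only [norm_mul, mul_pow] using summable_sq_mul x φ
  exact (sq_eq_sq₀ (norm_nonneg _) (by positivity)).1 h

/-- The map `x ↦ x ⊗ φ`. -/
def tensorVec (ι : Type*) {κ : Type*} (φ : Fock κ) : Fock ι →L[ℂ] Fock (ι ⊕ κ) :=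
  LinearMap.mkContinuous
    { toFun := tensorVecAux φ
      map_add' := fun x y => by
        ext z
        exact add_mul (x _) (y _) _
      map_smul' := fun c x => by
        ext z
        exact mul_assoc c (x _) _ } ‖φ‖ fun x => (norm_tensorVecAux φ x).le

@[simp] theorem tensorVec_apply (φ : Fock κ) (x : Fock ι) (s : ι → ℕ) (a : κ → ℕ) :
    tensorVec ι φ x (Sum.elim s a) = x s * φ a := rfl

theorem norm_tensorVec_le (φ : Fock κ) : ‖tensorVec ι φ‖ ≤ ‖φ‖ :=
  LinearMap.mkContinuous_norm_le _ (norm_nonneg _) _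

theorem tensorVec_coherentState [Fintype ι] [Fintype κ] (α : ι → ℂ) (β : κ → ℂ) :
    tensorVec ι (coherentState β) (coherentState α) = coherentState (Sum.elim α β) := by
  ext z
  obtain ⟨s, a, rfl⟩ := sumElim_surjective z
  rw [tensorVec_apply, coherentState_sumElim]

theorem adjoint_tensorVec_numberState (φ : Fock κ) (t : ι → ℕ) (b : κ → ℕ) :
    adjoint (tensorVec ι φ) (numberState (Sum.elim t b)) = star (φ b) • numberState t := by
  refine ext_inner_left ℂ fun x => ?_
  rw [ContinuousLinearMap.adjoint_inner_right, inner_numberState_right, inner_smul_right,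
    inner_numberState_right, tensorVec_apply, star_mul]

theorem entry_rankOne_self (φ : Fock κ) (a b : κ → ℕ) :
    entry (rankOne ℂ φ φ) a b = φ a * star (φ b) := by
  rw [entry, InnerProductSpace.rankOne_apply, inner_numberState_right, lp.coeFn_smul, Pi.smul_apply,
    smul_eq_mul, mul_comm]

/-- A pure ancilla acts by conjugation with x ↦ x ⊗ φ, so its output has the form K ρ K† required by
`exists_partialTrace`. -/
theorem tensor_rankOne (ρ : Fock ι →L[ℂ] Fock ι) (φ : Fock κ) :
    tensor ρ (rankOne ℂ φ φ) = tensorVec ι φ ∘L ρ ∘L adjoint (tensorVec ι φ) := by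
  refine entry_ext fun z w => ?_
  obtain ⟨s, a, rfl⟩ := sumElim_surjective z
  obtain ⟨t, b, rfl⟩ := sumElim_surjective w
  rw [entry_tensor, entry_rankOne_self]
  simp only [entry, ContinuousLinearMap.comp_apply]
  rw [adjoint_tensorVec_numberState, tensorVec_apply, map_smul, lp.coeFn_smul, Pi.smul_apply,
    smul_eq_mul]
  ring

theorem conj_tensor_rankOne (U : Fock (ν ⊕ κ) ≃ₗᵢ[ℂ] Fock ι) (ρ : Fock ν →L[ℂ] Fock ν)
    (φ : Fock κ) :
    (U : Fock (ν ⊕ κ) →L[ℂ] Fock ι) ∘L tensor ρ (rankOne ℂ φ φ) ∘L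
        (U.symm : Fock ι →L[ℂ] Fock (ν ⊕ κ))
      = ((U : Fock (ν ⊕ κ) →L[ℂ] Fock ι) ∘L tensorVec ν φ) ∘L ρ ∘L
        adjoint ((U : Fock (ν ⊕ κ) →L[ℂ] Fock ι) ∘L tensorVec ν φ) := by
  have hU : adjoint (U : Fock (ν ⊕ κ) →L[ℂ] Fock ι) = (U.symm : Fock ι →L[ℂ] Fock (ν ⊕ κ)) :=
    LinearIsometryEquiv.adjoint_eq_symm U
  rw [tensor_rankOne, ContinuousLinearMap.adjoint_comp, hU]
  rfl

theorem norm_tensor_rankOne_le (ρ : Fock ι →L[ℂ] Fock ι) {φ : Fock κ} (hφ : ‖φ‖ = 1) :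
    ‖tensor ρ (rankOne ℂ φ φ)‖ ≤ ‖ρ‖ := by
  have h : ‖tensorVec ι φ‖ ≤ 1 := (norm_tensorVec_le φ).trans hφ.le
  rw [tensor_rankOne]
  calc _ ≤ ‖tensorVec ι φ‖ * (‖ρ‖ * ‖adjoint (tensorVec ι φ)‖) :=
        (ContinuousLinearMap.opNorm_comp_le _ _).trans
          (mul_le_mul_of_nonneg_left (ContinuousLinearMap.opNorm_comp_le _ _) (norm_nonneg _))
    _ ≤ 1 * (‖ρ‖ * 1) := by
        rw [LinearIsometryEquiv.norm_map]
        gcongr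
    _ = ‖ρ‖ := by ring

end Ancilla

/-! ### Weak integrals of operators -/

section WeakIntegral

open MeasureTheory Filter Topology
open InnerProductSpace (rankOne)
open ContinuousLinearMap (adjoint)

variable {ι κ ν μ Ω : Type*} [MeasurableSpace Ω] {P : Measure Ω} [IsProbabilityMeasure P]

/-- A uniformly bounded family of operators can be integrated entrywise. -/
theorem inner_eq_integral_of_entry [Countable (ι → ℕ)] {A : Ω → Fock ι →L[ℂ] Fock ι}
    {R : Fock ι →L[ℂ] Fock ι} {C : ℝ} (hC : ∀ ω, ‖A ω‖ ≤ C)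
    (hA : ∀ s t, Integrable (fun ω => entry (A ω) s t) P)
    (hR : ∀ s t, entry R s t = ∫ ω, entry (A ω) s t ∂P) (φ ψ : Fock ι) :
    Integrable (fun ω => inner ℂ φ (A ω ψ)) P ∧
      inner ℂ φ (R ψ) = ∫ ω, inner ℂ φ (A ω ψ) ∂P := by
  let φF : Finset (ι → ℕ) → Fock ι := fun F => ∑ k ∈ F, φ k • numberState k
  let ψF : Finset (ι → ℕ) → Fock ι := fun F => ∑ k ∈ F, ψ k • numberState k
  have hφ : Tendsto φF atTop (𝓝 φ) := hasSum_numberState φ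
  have hψ : Tendsto ψF atTop (𝓝 ψ) := hasSum_numberState ψ
  have hexp : ∀ (T : Fock ι →L[ℂ] Fock ι) F, inner ℂ (φF F) (T (ψF F))
      = ∑ k ∈ F, ∑ l ∈ F, (star (φ k) * ψ l) * entry T k l := by
    intro T F
    simp only [φF, ψF, map_sum, sum_inner, inner_sum, map_smul, inner_smul_left, inner_smul_right,
      ← entry_eq_inner, RCLike.star_def, Finset.mul_sum]
    rw [Finset.sum_comm]
    exact Finset.sum_congr rfl fun k _ => Finset.sum_congr rfl fun l _ => by ring
  have hint : ∀ F, Integrable (fun ω => inner ℂ (φF F) (A ω (ψF F))) P := by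
    intro F
    simp only [hexp]
    exact integrable_finsetSum _ fun k _ => integrable_finsetSum _ fun l _ =>
      (hA k l).const_mul _
  have hRF : ∀ F, inner ℂ (φF F) (R (ψF F)) = ∫ ω, inner ℂ (φF F) (A ω (ψF F)) ∂P := by
    intro F
    simp only [hexp]
    rw [integral_finsetSum _ fun k _ => integrable_finsetSum _ fun l _ => (hA k l).const_mul _]
    refine Finset.sum_congr rfl fun k _ => ?_
    rw [integral_finsetSum _ fun l _ => (hA k l).const_mul _]
    refine Finset.sum_congr rfl fun l _ => ?_
    rw [integral_const_mul, hR]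
  have hlim : ∀ T : Fock ι →L[ℂ] Fock ι,
      Tendsto (fun F => inner ℂ (φF F) (T (ψF F))) atTop (𝓝 (inner ℂ φ (T ψ))) := fun T =>
    hφ.inner ((T.continuous.tendsto ψ).comp hψ)
  have hbd : ∀ (x y : Fock ι) ω, ‖inner ℂ x (A ω y)‖ ≤ ‖x‖ * (C * ‖y‖) := fun x y ω =>
    (norm_inner_le_norm _ _).trans
      (mul_le_mul_of_nonneg_left ((A ω).le_of_opNorm_le (hC ω) y) (norm_nonneg _))
  -- Countability of the number basis makes the filter of its finite subsets countably generated, so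
  -- sequential limit theorems apply to the truncations.
  have hmeas : AEStronglyMeasurable (fun ω => inner ℂ φ (A ω ψ)) P :=
    aestronglyMeasurable_of_tendsto_ae atTop (fun F => (hint F).aestronglyMeasurable)
      (Eventually.of_forall fun ω => hlim (A ω))
  refine ⟨Integrable.of_bound hmeas _ (Eventually.of_forall (hbd φ ψ)), ?_⟩
  refine tendsto_nhds_unique (hlim R) ?_
  simp only [hRF]
  refine tendsto_integral_filter_of_dominated_convergence
    (fun _ => (‖φ‖ + 1) * (|C| * (‖ψ‖ + 1)))
    (Eventually.of_forall fun F => (hint F).aestronglyMeasurable) ?_ (integrable_const _)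
    (Eventually.of_forall fun ω => hlim (A ω))
  have hφ1 : ∀ᶠ F in atTop, ‖φF F‖ ≤ ‖φ‖ + 1 :=
    hφ.norm.eventually_le_const (lt_add_one _)
  have hψ1 : ∀ᶠ F in atTop, ‖ψF F‖ ≤ ‖ψ‖ + 1 :=
    hψ.norm.eventually_le_const (lt_add_one _)
  filter_upwards [hφ1, hψ1] with F h1 h2
  refine Eventually.of_forall fun ω => (hbd _ _ ω).trans ?_
  have hC' := le_abs_self C
  refine (mul_le_mul_of_nonneg_left (mul_le_mul_of_nonneg_right hC' (norm_nonneg _))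
    (norm_nonneg _)).trans ?_
  gcongr

variable [Fintype μ]

/-- The projection onto a coherent state. -/
def coherentProj (β : μ → ℂ) : Fock μ →L[ℂ] Fock μ :=
  rankOne ℂ (coherentState β) (coherentState β)

theorem inner_coherentProj (β : μ → ℂ) (φ ψ : Fock μ) :
    inner ℂ φ (coherentProj β ψ)
      = inner ℂ φ (coherentState β) * inner ℂ (coherentState β) ψ := by
  rw [coherentProj, InnerProductSpace.rankOne_apply, inner_smul_right, mul_comm]

theorem norm_coherentProj (β : μ → ℂ) : ‖coherentProj β‖ = 1 := by
  rw [coherentProj, InnerProductSpace.norm_rankOne, norm_coherentState, mul_one]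

theorem isCoherent_coherentProj (β : μ → ℂ) : IsCoherent (coherentProj β) :=
  ⟨β, inner_coherentProj β⟩

theorem IsCoherent.exists_eq {σ : Fock μ →L[ℂ] Fock μ} (h : IsCoherent σ) :
    ∃ β, σ = coherentProj β := by
  obtain ⟨β, hβ⟩ := h
  exact ⟨β, ContinuousLinearMap.ext fun ψ => ext_inner_left ℂ fun φ => by
    rw [hβ, inner_coherentProj]⟩

theorem stronglyMeasurable_inner_coherentProj {f : Ω → μ → ℂ} (hf : Measurable f) (φ ψ : Fock μ) :
    StronglyMeasurable fun ω => inner ℂ φ (coherentProj (f ω) ψ) := by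
  have hc : Continuous fun β : μ → ℂ => inner ℂ φ (coherentProj β ψ) := by
    simp only [inner_coherentProj]
    have := continuous_coherentState (ι := μ)
    fun_prop
  exact hc.stronglyMeasurable.comp_measurable hf

theorem integrable_entry_coherentProj {f : Ω → μ → ℂ} (hf : Measurable f) (a b : μ → ℕ) :
    Integrable (fun ω => entry (coherentProj (f ω)) a b) P := by
  refine Integrable.of_bound (C := 1) ?_ (Eventually.of_forall fun ω => ?_)
  · simp only [entry_eq_inner]
    exact (stronglyMeasurable_inner_coherentProj hf _ _).aestronglyMeasurable
  · exact (norm_entry_le _ _ _).trans (norm_coherentProj _).le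

/-- Mixtures of coherent states are classical. -/
theorem exists_isClassical {f : Ω → μ → ℂ} (hf : Measurable f) :
    ∃ σ : Fock μ →L[ℂ] Fock μ, IsClassical σ ∧
      ∀ φ ψ, inner ℂ φ (σ ψ) = ∫ ω, inner ℂ φ (coherentProj (f ω) ψ) ∂P := by
  -- Norm continuity of β ↦ |β⟩⟨β| allows a Bochner integral against the law of f.
  have hcont : Continuous (coherentProj (μ := μ)) := by
    have h := continuous_coherentState (ι := μ)
    exact (ContinuousLinearMap.smulRightL ℂ (Fock μ) (Fock μ)).continuous₂.comp
      (((innerSL ℂ).continuous.comp h).prodMk h)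
  have hP : IsProbabilityMeasure (P.map f) := Measure.isProbabilityMeasure_map hf.aemeasurable
  have hint : Integrable (coherentProj (μ := μ)) (P.map f) :=
    Integrable.of_bound hcont.aestronglyMeasurable 1
      (Eventually.of_forall fun β => (norm_coherentProj β).le)
  have hσ : ∀ φ ψ, inner ℂ φ ((∫ β, coherentProj β ∂(P.map f)) ψ)
      = ∫ β, inner ℂ φ (coherentProj β ψ) ∂(P.map f) := by
    intro φ ψ
    exact ((innerSL ℂ φ ∘L ContinuousLinearMap.apply ℂ (Fock μ) ψ).integral_comp_comm hint).symm
  refine ⟨∫ β, coherentProj β ∂(P.map f), ⟨P.map f, hP, fun φ ψ => ?_⟩, fun φ ψ => ?_⟩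
  · simp only [hσ, inner_coherentProj]
  · have h := stronglyMeasurable_inner_coherentProj (f := fun β : μ → ℂ => β) measurable_id φ ψ
    rw [hσ, integral_map hf.aemeasurable h.aestronglyMeasurable]

variable [Fintype ν]

/-- Entries of a tensor product factor, so the weak integral over the ancilla passes through
entrywise; the uniform bound ‖ρ‖ extends it to all vectors. -/
theorem inner_tensor_eq_integral {f : Ω → μ → ℂ} (hf : Measurable f) {σ : Fock μ →L[ℂ] Fock μ}
    (hσ : ∀ φ ψ, inner ℂ φ (σ ψ) = ∫ ω, inner ℂ φ (coherentProj (f ω) ψ) ∂P)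
    (ρ : Fock ν →L[ℂ] Fock ν) (φ ψ : Fock (ν ⊕ μ)) :
    Integrable (fun ω => inner ℂ φ (tensor ρ (coherentProj (f ω)) ψ)) P ∧
      inner ℂ φ (tensor ρ σ ψ) = ∫ ω, inner ℂ φ (tensor ρ (coherentProj (f ω)) ψ) ∂P := by
  refine inner_eq_integral_of_entry (C := ‖ρ‖)
    (fun ω => norm_tensor_rankOne_le ρ (norm_coherentState _)) (fun z w => ?_) (fun z w => ?_) φ ψ
  · obtain ⟨s, a, rfl⟩ := sumElim_surjective z
    obtain ⟨t, b, rfl⟩ := sumElim_surjective w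
    simp only [entry_tensor]
    exact (integrable_entry_coherentProj hf a b).const_mul _
  · obtain ⟨s, a, rfl⟩ := sumElim_surjective z
    obtain ⟨t, b, rfl⟩ := sumElim_surjective w
    simp only [entry_tensor]
    rw [entry_eq_inner σ, hσ]
    simp only [← entry_eq_inner]
    exact (integral_const_mul _ _).symm

/-- Partial traces can be integrated over the amplitude of the ancilla. -/
theorem hasSum_entry_integral [Countable (κ → ℕ)] {f : Ω → μ → ℂ} (hf : Measurable f)
    {σ : Fock μ →L[ℂ] Fock μ}
    (hσ : ∀ φ ψ, inner ℂ φ (σ ψ) = ∫ ω, inner ℂ φ (coherentProj (f ω) ψ) ∂P)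
    (ρ : Fock ν →L[ℂ] Fock ν) (A : Fock (ν ⊕ μ) →L[ℂ] Fock (ι ⊕ κ))
    (B : Fock (ι ⊕ κ) →L[ℂ] Fock (ν ⊕ μ)) {R : Ω → Fock ι →L[ℂ] Fock ι}
    (hR : ∀ ω, IsPartialTrace (A ∘L tensor ρ (coherentProj (f ω)) ∘L B) (R ω)) {C : ℝ}
    (hC : ∀ ω (s t : ι → ℕ) (F : Finset (κ → ℕ)), ∑ a ∈ F,
      ‖entry (A ∘L tensor ρ (coherentProj (f ω)) ∘L B) (Sum.elim s a) (Sum.elim t a)‖ ≤ C)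
    (s t : ι → ℕ) :
    Integrable (fun ω => entry (R ω) s t) P ∧
      HasSum (fun a : κ → ℕ => entry (A ∘L tensor ρ σ ∘L B) (Sum.elim s a) (Sum.elim t a))
        (∫ ω, entry (R ω) s t ∂P) := by
  have hent : ∀ (τ : Fock μ →L[ℂ] Fock μ) (z w : ι ⊕ κ → ℕ), entry (A ∘L tensor ρ τ ∘L B) z w
      = inner ℂ (adjoint A (numberState z)) (tensor ρ τ (B (numberState w))) := by
    intro τ z w
    rw [entry_eq_inner, ContinuousLinearMap.adjoint_inner_left]
    rfl
  have hI := inner_tensor_eq_integral hf hσ ρ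
  have hint : ∀ a : κ → ℕ, Integrable (fun ω => entry (A ∘L tensor ρ (coherentProj (f ω)) ∘L B)
      (Sum.elim s a) (Sum.elim t a)) P := fun a => by
    simp only [hent]
    exact (hI _ _).1
  -- The bound C, uniform in ω and in the finite set, is what permits exchanging the sum over `a`
  -- with the integral.
  have hsum : Summable fun a : κ → ℕ => ∫ ω, ‖entry (A ∘L tensor ρ (coherentProj (f ω)) ∘L B)
      (Sum.elim s a) (Sum.elim t a)‖ ∂P := by
    refine summable_of_sum_le (c := C) (fun a => integral_nonneg fun ω => norm_nonneg _)
      fun F => ?_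
    rw [← integral_finsetSum _ fun a _ => (hint a).norm]
    refine (integral_mono (integrable_finsetSum _ fun a _ => (hint a).norm)
      (integrable_const C) fun ω => hC ω s t F).trans ?_
    simp
  have h := hasSum_integral_of_summable_integral_norm hint hsum
  simp only [(hR _ s t).tsum_eq] at h
  refine ⟨?_, h.of_eq (fun a => ?_) rfl⟩
  · have hlim : ∀ ω, Tendsto (fun F : Finset (κ → ℕ) => ∑ a ∈ F,
        entry (A ∘L tensor ρ (coherentProj (f ω)) ∘L B) (Sum.elim s a) (Sum.elim t a)) atTop
        (𝓝 (entry (R ω) s t)) := fun ω => hR ω s t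
    refine Integrable.of_bound (C := C) (aestronglyMeasurable_of_tendsto_ae atTop
      (fun F => (integrable_finsetSum F fun a _ => hint a).aestronglyMeasurable)
      (Eventually.of_forall hlim)) (Eventually.of_forall fun ω => ?_)
    exact le_of_tendsto (hlim ω).norm (Eventually.of_forall fun F =>
      (norm_sum_le _ _).trans (hC ω s t F))
  · simp only [hent]
    exact (hI _ _).2

end WeakIntegral

/-! ### Instruments with a coherent or classical ancilla -/

section Instruments

open MeasureTheory
open ContinuousLinearMap (adjoint)

theorem IsPartialTrace.unique {ι κ : Type*} {T : Fock (ι ⊕ κ) →L[ℂ] Fock (ι ⊕ κ)}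
    {R R' : Fock ι →L[ℂ] Fock ι} (h : IsPartialTrace T R) (h' : IsPartialTrace T R') : R = R' :=
  entry_ext fun s t => (h s t).unique (h' s t)

theorem isClassical_coherentProj {ι : Type*} [Fintype ι] (β : ι → ℂ) :
    IsClassical (coherentProj β) :=
  ⟨Measure.dirac β, inferInstance, fun φ ψ => by rw [inner_coherentProj, integral_dirac]⟩

/-- Conjugation preserves positivity, and normalization needs only L† L = 1; L need not be
surjective. -/
theorem IsPOVM.conj_isometry {ι κ M : Type*} {E : M → Fock κ →L[ℂ] Fock κ} (hE : IsPOVM E)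
    (L : Fock ι →ₗᵢ[ℂ] Fock κ) :
    IsPOVM fun m => adjoint L.toContinuousLinearMap ∘L E m ∘L L.toContinuousLinearMap := by
  refine ⟨fun m => (hE.1 m).adjoint_conj _, fun ψ => ?_⟩
  have h := (hE.2 (L ψ)).mapL (adjoint L.toContinuousLinearMap)
  have h2 : adjoint L.toContinuousLinearMap (L ψ) = ψ :=
    congrArg (fun T : Fock ι →L[ℂ] Fock ι => T ψ) L.adjoint_comp_self
  rw [h2] at h
  exact h

variable {M : Type*} {n n' r q : ℕ}

/-- The map `x ↦ U (x ⊗ |β⟩)`. -/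
def attach (U : Fock (Fin n ⊕ Fin r) ≃ₗᵢ[ℂ] Fock (Fin n' ⊕ Fin q)) (β : Fin r → ℂ) :
    Fock (Fin n) →L[ℂ] Fock (Fin n' ⊕ Fin q) :=
  (U : Fock (Fin n ⊕ Fin r) →L[ℂ] Fock (Fin n' ⊕ Fin q)) ∘L
    tensorVec (Fin n) (coherentState β)

theorem norm_attach_le (U : Fock (Fin n ⊕ Fin r) ≃ₗᵢ[ℂ] Fock (Fin n' ⊕ Fin q)) (β : Fin r → ℂ) :
    ‖attach U β‖ ≤ 1 := by
  refine ContinuousLinearMap.opNorm_le_bound _ zero_le_one fun x => ?_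
  have h : ‖attach U β x‖ = ‖tensorVec (Fin n) (coherentState β) x‖ := U.norm_map _
  rw [h]
  exact (tensorVec (Fin n) (coherentState β)).le_of_opNorm_le
    ((norm_tensorVec_le _).trans (norm_coherentState β).le) x

theorem conj_tensor_coherentProj (U : Fock (Fin n ⊕ Fin r) ≃ₗᵢ[ℂ] Fock (Fin n' ⊕ Fin q))
    (ρ : Fock (Fin n) →L[ℂ] Fock (Fin n)) (β : Fin r → ℂ) :
    (U : Fock (Fin n ⊕ Fin r) →L[ℂ] Fock (Fin n' ⊕ Fin q)) ∘L tensor ρ (coherentProj β) ∘L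
        (U.symm : Fock (Fin n' ⊕ Fin q) →L[ℂ] Fock (Fin n ⊕ Fin r))
      = attach U β ∘L ρ ∘L adjoint (attach U β) :=
  conj_tensor_rankOne U ρ (coherentState β)

/-- The unnormalized output state before the trace over the measured modes. -/
def output (U : Fock (Fin n ⊕ Fin r) ≃ₗᵢ[ℂ] Fock (Fin n' ⊕ Fin q))
    (E : Fock (Fin q) →L[ℂ] Fock (Fin q)) (σ : Fock (Fin r) →L[ℂ] Fock (Fin r))
    (ρ : Fock (Fin n) →L[ℂ] Fock (Fin n)) : Fock (Fin n' ⊕ Fin q) →L[ℂ] Fock (Fin n' ⊕ Fin q) :=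
  onRight (Fin n') E ∘L (U : Fock (Fin n ⊕ Fin r) →L[ℂ] Fock (Fin n' ⊕ Fin q)) ∘L
    tensor ρ σ ∘L (U.symm : Fock (Fin n' ⊕ Fin q) →L[ℂ] Fock (Fin n ⊕ Fin r))

theorem output_coherentProj (U : Fock (Fin n ⊕ Fin r) ≃ₗᵢ[ℂ] Fock (Fin n' ⊕ Fin q))
    (E : Fock (Fin q) →L[ℂ] Fock (Fin q)) (β : Fin r → ℂ)
    (ρ : Fock (Fin n) →L[ℂ] Fock (Fin n)) :
    output U E (coherentProj β) ρ
      = onRight (Fin n') E ∘L attach U β ∘L ρ ∘L adjoint (attach U β) := by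
  rw [output, conj_tensor_coherentProj]

/-- A coherent ancilla, a passive linear unitary and a POVM realize an instrument. -/
theorem exists_coherent_instrument (U : Fock (Fin n ⊕ Fin r) ≃ₗᵢ[ℂ] Fock (Fin n' ⊕ Fin q))
    {E : M → Fock (Fin q) →L[ℂ] Fock (Fin q)} (hE : ∀ m, (E m).IsPositive) :
    ∃ J : (Fin r → ℂ) → Instrument M n n',
      (∀ β, IsRealizedBy (J β) (coherentProj β) U E) ∧
      ∀ m (ρ : traceClass (Fin n)), ∃ C : ℝ, ∀ β,
        ‖(J β m ρ : Fock (Fin n') →L[ℂ] Fock (Fin n'))‖ ≤ C ∧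
        ∀ (s t : Fin n' → ℕ) (F : Finset (Fin q → ℕ)), ∑ a ∈ F,
          ‖entry (output U (E m) (coherentProj β) ρ) (Sum.elim s a) (Sum.elim t a)‖ ≤ C := by
  have h : ∀ m (ρ : traceClass (Fin n)), ∃ C : ℝ, ∀ β, ∃ R : traceClass (Fin n'),
      ‖(R : Fock (Fin n') →L[ℂ] Fock (Fin n'))‖ ≤ C ∧
      IsPartialTrace (output U (E m) (coherentProj β) ρ) R ∧
      ∀ (s t : Fin n' → ℕ) (F : Finset (Fin q → ℕ)), ∑ a ∈ F,
        ‖entry (output U (E m) (coherentProj β) ρ) (Sum.elim s a) (Sum.elim t a)‖ ≤ C := by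
    intro m ρ
    obtain ⟨C, hC⟩ := exists_partialTrace (ι := Fin n') (hE m) ρ.2
    refine ⟨C, fun β => ?_⟩
    obtain ⟨R, hR, h⟩ := hC (attach U β) (norm_attach_le U β)
    rw [output_coherentProj]
    exact ⟨⟨R, hR⟩, h⟩
  choose C R hR using h
  refine ⟨fun β m =>
    { toFun := fun ρ => R m ρ β
      map_add' := fun ρ₁ ρ₂ => Subtype.ext ?_
      map_smul' := fun c ρ => Subtype.ext ?_ }, fun β m ρ => (hR m ρ β).2.1,
      fun m ρ => ⟨C m ρ, fun β => ⟨(hR m ρ β).1, (hR m ρ β).2.2⟩⟩⟩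
  -- The value at each ρ was merely chosen; linearity follows from the uniqueness of partial traces.
  · refine (hR m (ρ₁ + ρ₂) β).2.1.unique fun s t => ?_
    refine (((hR m ρ₁ β).2.1 s t).add ((hR m ρ₂ β).2.1 s t)).of_eq (fun a => ?_) rfl
    rw [← entry_add]
    congr 1
    simp only [output_coherentProj, Submodule.coe_add, ContinuousLinearMap.add_comp,
      ContinuousLinearMap.comp_add]
  · refine (hR m (c • ρ) β).2.1.unique fun s t => ?_
    refine (((hR m ρ β).2.1 s t).mul_left c).of_eq (fun a => ?_) rfl
    rw [← entry_smul]
    congr 1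
    simp only [output_coherentProj, Submodule.coe_smul, ContinuousLinearMap.smul_comp,
      ContinuousLinearMap.comp_smul]

/-- Integration over the amplitude of the ancilla. -/
theorem hasSum_entry_output {Ω : Type*} [MeasurableSpace Ω] {P : Measure Ω}
    [IsProbabilityMeasure P] {f : Ω → Fin r → ℂ} (hf : Measurable f)
    {σ : Fock (Fin r) →L[ℂ] Fock (Fin r)}
    (hσ : ∀ φ ψ, inner ℂ φ (σ ψ) = ∫ ω, inner ℂ φ (coherentProj (f ω) ψ) ∂P)
    (U : Fock (Fin n ⊕ Fin r) ≃ₗᵢ[ℂ] Fock (Fin n' ⊕ Fin q))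
    {E : Fock (Fin q) →L[ℂ] Fock (Fin q)} (hE : E.IsPositive) (ρ : traceClass (Fin n))
    {R : Ω → Fock (Fin n') →L[ℂ] Fock (Fin n')}
    (hR : ∀ ω, IsPartialTrace (output U E (coherentProj (f ω)) ρ) (R ω)) (s t : Fin n' → ℕ) :
    Integrable (fun ω => entry (R ω) s t) P ∧
      HasSum (fun a : Fin q → ℕ => entry (output U E σ ρ) (Sum.elim s a) (Sum.elim t a))
        (∫ ω, entry (R ω) s t ∂P) := by
  -- Only the bound, uniform over all amplitudes, is taken from this one-outcome instrument.
  obtain ⟨J, -, hJ⟩ := exists_coherent_instrument (M := Unit) U (E := fun _ => E) fun _ => hE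
  obtain ⟨C, hC⟩ := hJ () ρ
  exact hasSum_entry_integral hf hσ (ρ : Fock (Fin n) →L[ℂ] Fock (Fin n))
    (onRight (Fin n') E ∘L (U : Fock (Fin n ⊕ Fin r) →L[ℂ] Fock (Fin n' ⊕ Fin q)))
    (U.symm : Fock (Fin n' ⊕ Fin q) →L[ℂ] Fock (Fin n ⊕ Fin r)) hR (fun ω => (hC (f ω)).2) s t

/-- With a coherent ancilla, `n'` ancilla modes suffice. -/
theorem exists_reduction (M : Type*) {U : Fock (Fin n ⊕ Fin r) ≃ₗᵢ[ℂ] Fock (Fin n' ⊕ Fin q)}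
    (hU : IsPassiveLinear U) :
    ∃ r' ≤ n', ∃ (q' : ℕ) (U' : Fock (Fin n ⊕ Fin r') ≃ₗᵢ[ℂ] Fock (Fin n' ⊕ Fin q'))
      (V : Matrix (Fin r') (Fin r) ℂ) (L : (Fin r → ℂ) → Fock (Fin q') →ₗᵢ[ℂ] Fock (Fin q)),
      IsPassiveLinear U' ∧ ∀ (β : Fin r → ℂ) (E : M → Fock (Fin q) →L[ℂ] Fock (Fin q))
        (I : Instrument M n n'), IsRealizedBy I (coherentProj β) U E →
        IsRealizedBy I (coherentProj (V *ᵥ β)) U'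
          fun m => adjoint (L β).toContinuousLinearMap ∘L E m ∘L (L β).toContinuousLinearMap := by
  obtain ⟨u, c, hu1, hu2, hc, hUc⟩ := hU.exists_coherentState
  obtain ⟨r', hr', q', u', V, W, B, hu1', hu2', hW, hWB, hred⟩ := exists_reduced_unitary hu1 hu2
  obtain ⟨U', hU', hUc'⟩ := exists_isPassiveLinear hu1' hu2'
  -- The modes removed from the output carry the fixed amplitude B β; L restores them in the state
  -- they would have had.
  have hL : ∀ β : Fin r → ℂ, ∃ L : Fock (Fin q') →ₗᵢ[ℂ] Fock (Fin q),
      ∀ y, L (coherentState y) = coherentState (W *ᵥ y + B *ᵥ β) := fun β =>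
    exists_isometry_coherentState _ <| inner_coherentState_mulVec_add hW
      (by rw [Matrix.mulVec_mulVec, hWB, Matrix.zero_mulVec])
  choose L hL using hL
  refine ⟨r', hr', q', U', V, L, hU', fun β E I hI m ρ s t => ?_⟩
  -- This is U(x ⊗ |β⟩) = c (1 ⊗ L_β) U'(x ⊗ |V β⟩), read off row by row and checked on coherent x.
  have hK : ∀ (s : Fin n' → ℕ) x, row s (attach U β x)
      = c • (L β).toContinuousLinearMap (row s (attach U' (V *ᵥ β) x)) := by
    intro s x
    have h : row s ∘L attach U β
        = c • (L β).toContinuousLinearMap ∘L row s ∘L attach U' (V *ᵥ β) := by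
      refine clm_ext_coherentState fun α => ?_
      obtain ⟨x, y, h1, h2⟩ := hred α β
      have e1 : attach U β (coherentState α)
          = c • coherentState (Sum.elim x (W *ᵥ y + B *ᵥ β)) := by
        rw [← h2, ← hUc, ← tensorVec_coherentState]; rfl
      have e2 : attach U' (V *ᵥ β) (coherentState α) = coherentState (Sum.elim x y) := by
        rw [← h1, ← hUc', ← tensorVec_coherentState]; rfl
      rw [ContinuousLinearMap.comp_apply, e1, map_smul, row_coherentState, smul_apply,
        ContinuousLinearMap.comp_apply, ContinuousLinearMap.comp_apply, e2, row_coherentState,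
        map_smul, LinearIsometry.coe_toContinuousLinearMap, hL]
    exact congrArg (fun T : Fock (Fin n) →L[ℂ] Fock (Fin q) => T x) h
  obtain ⟨v, h1, h2⟩ := exists_hasSum_entry_transfer (E m) ρ.2 hc hK s t
  have h3 := hI m ρ s t
  rw [conj_tensor_coherentProj] at h3 ⊢
  rw [h3.unique h1]
  exact h2

/-- The random variable is the amplitude β itself, distributed by P. Measurability of β ↦ L β is
never needed: integrability is proved for `J β` in its original realization by U and E. -/
theorem mem_P1MixtureWith {I : Instrument M n n'} (hI : I ∈ P1 M n n') :
    ∃ r ≤ n', I ∈ P1MixtureWith M n n' r := by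
  obtain ⟨r, q, σ, U, E, ⟨P, hP, hσ⟩, hU, hE, hI⟩ := Set.mem_iUnion.1 hI
  simp only [← inner_coherentProj] at hσ
  obtain ⟨r', hr', q', U', V, L, hU', hred⟩ := exists_reduction M hU
  obtain ⟨J, hJ, hJb⟩ := exists_coherent_instrument U hE.1
  refine ⟨r', hr', q', U', Fin r → ℂ, inferInstance, P, fun β => coherentProj (V *ᵥ β),
    fun β m => adjoint (L β).toContinuousLinearMap ∘L E m ∘L (L β).toContinuousLinearMap, J,
    hU', hP, fun β => ⟨isClassical_coherentProj _, hE.conj_isometry (L β), hred β E (J β) (hJ β)⟩,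
    fun m ρ φ ψ => ?_⟩
  obtain ⟨C, hC⟩ := hJb m ρ
  have h := hasSum_entry_output measurable_id hσ U (hE.1 m) ρ (fun β => hJ β m ρ)
  exact inner_eq_integral_of_entry (fun β => (hC β).1) (fun s t => (h s t).1)
    (fun s t => (hI m ρ s t).unique (h s t).2) φ ψ

theorem IsPOVM.eq_one {κ : Type*} [Subsingleton M] {E : M → Fock κ →L[ℂ] Fock κ}
    (hE : IsPOVM E) (m : M) : E m = 1 := by
  ext1 ψ
  have : Unique M := uniqueOfSubsingleton m
  have h := (hE.2 ψ).unique (hasSum_unique _)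
  rw [Subsingleton.elim m default]
  exact h.symm

/-- The only effect is the identity, which every L β conjugates to the identity. The reduced
measurement thus forgets β, and mixing the |V β⟩ into one ancilla state suffices. -/
theorem mem_P1With_of_subsingleton [Subsingleton M] {I : Instrument M n n'}
    (hI : I ∈ P1 M n n') : ∃ r ≤ n', I ∈ P1With M n n' r := by
  obtain ⟨r, q, σ, U, E, ⟨P, hP, hσ⟩, hU, hE, hI⟩ := Set.mem_iUnion.1 hI
  simp only [← inner_coherentProj] at hσ
  obtain ⟨r', hr', q', U', V, L, hU', hred⟩ := exists_reduction M hU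
  obtain ⟨J, hJ, -⟩ := exists_coherent_instrument U hE.1
  have hV : Measurable fun β : Fin r → ℂ => V *ᵥ β :=
    (Continuous.matrix_mulVec continuous_const continuous_id).measurable
  obtain ⟨σ', hσc, hσ'⟩ := exists_isClassical (P := P) hV
  -- The amplitude 0 is an arbitrary choice; any other gives the same operators.
  let F : M → Fock (Fin q') →L[ℂ] Fock (Fin q') := fun m =>
    adjoint (L 0).toContinuousLinearMap ∘L E m ∘L (L 0).toContinuousLinearMap
  have hF : IsPOVM F := hE.conj_isometry (L 0)
  refine ⟨r', hr', q', σ', U', F, hσc, hU', hF, fun m ρ s t => ?_⟩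
  have h := hasSum_entry_output measurable_id hσ U (hE.1 m) ρ (fun β => hJ β m ρ) s t
  have hR : ∀ β, IsPartialTrace (output U' (F m) (coherentProj (V *ᵥ β)) ρ) (J β m ρ) := by
    intro β
    have hβ := hred β E (J β) (hJ β) m ρ
    have e : F m = adjoint (L β).toContinuousLinearMap ∘L E m ∘L (L β).toContinuousLinearMap :=
      (hF.eq_one m).trans ((hE.conj_isometry (L β)).eq_one m).symm
    rw [e]
    exact hβ
  rw [(hI m ρ s t).unique h.2]
  exact (hasSum_entry_output hV hσ' U' (hF.1 m) ρ hR s t).2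

theorem mem_P1CoherentWith {I : Instrument M n n'} (hI : ∃ s, I ∈ P1CoherentWith M n n' s) :
    ∃ r ≤ n', I ∈ P1CoherentWith M n n' r := by
  obtain ⟨r, q, σ, U, E, hσ, hU, hE, hI⟩ := hI
  obtain ⟨β, rfl⟩ := hσ.exists_eq
  obtain ⟨r', hr', q', U', V, L, hU', hred⟩ := exists_reduction M hU
  exact ⟨r', hr', q', _, U', _, isCoherent_coherentProj _, hU', hE.conj_isometry (L β),
    hred β E I hI⟩

end Instruments

end Bosonic

end

theorem lemma1 {M : Type*} (n n' : ℕ) (I : Bosonic.Instrument M n n') :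
    (I ∈ Bosonic.P1 M n n' → ∃ r ≤ n', I ∈ Bosonic.P1MixtureWith M n n' r) ∧
    (I ∈ Bosonic.P1 M n n' → Subsingleton M → ∃ r ≤ n', I ∈ Bosonic.P1With M n n' r) ∧
    ((∃ s, I ∈ Bosonic.P1CoherentWith M n n' s) →
      ∃ r ≤ n', I ∈ Bosonic.P1CoherentWith M n n' r) :=
  ⟨Bosonic.mem_P1MixtureWith, fun h _ => Bosonic.mem_P1With_of_subsingleton h,
    Bosonic.mem_P1CoherentWith⟩
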